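/- Let $\mathcal H$ be a finite-dimensional complex Hilbert space and let $A_1,A_2,C$ be positive semi-definite operators on $\mathcal H$. Inequalities between operators are in the L\"owner (positive semi-definite) order, $\mathbb N=\{1,2,\dots\}$, $A^{\otimes n}$ denotes the $n$-fold tensor power of $A$ on $\mathcal H^{\otimes n}$, $\log 0:=-\infty$ and $0^0:=1$. For positive semi-definite $A,B$ and $t\in[0,1]$ the $t$-weighted Kubo--Ando geometric mean is $$B\#_tA:=\lim_{\varepsilon\searrow0}(B+\varepsilon I)^{1/2}\Big((B+\varepsilon I)^{-1/2}(A+\varepsilon I)(B+\varepsilon I)^{-1/2}\Big)^t(B+\varepsilon I)^{1/2}$$ (this limit exists). Then the following are equivalent: (i) For every $n\in\mathbb N$ and every positive semi-definite operator $X$ on $\mathcal H^{\otimes n}$, $$\operatorname{Tr}C^{\otimes n}X\le\max\{\operatorname{Tr}A_1^{\otimes n}X,\ \operatorname{Tr}A_2^{\otimes n}X\}.$$ (ii) There exists $p\in[0,1]$ such that $C^{\otimes n}\le pA_1^{\otimes n}+(1-p)A_2^{\otimes n}$ for every $n\in\mathbb N$. (iii) There exist $p_n,q_n\in[0,+\infty)$,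 $n\in\mathbb N$, such that $C^{\otimes n}\le p_nA_1^{\otimes n}+q_nA_2^{\otimes n}$ for every $n\in\mathbb N$, and $$\lim_{n\to+\infty}\frac1n\log(p_n+q_n)=0.$$ (iv) There exists $t\in[0,1]$ such that for every $n\in\mathbb N$ and every positive semi-definite operator $X$ on $\mathcal H^{\otimes n}$, $$\operatorname{Tr}C^{\otimes n}X\le(\operatorname{Tr}A_1^{\otimes n}X)^{t}\,(\operatorname{Tr}A_2^{\otimes n}X)^{1-t}.$$ (v) There exists $t\in[0,1]$ such that $C\le A_2\#_tA_1$. -/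

import Mathlib

open Set Filter Topology
open scoped TensorProduct

noncomputable section

namespace KuboAndoPowers

variable (H : Type*) [NormedAddCommGroup H] [InnerProductSpace ℂ H]

/-- The `n`-fold tensor power of the Hilbert space `H`. It is a copy of Mathlib's
`⨂[ℂ] _ : Fin n, H`, kept apart from it so that it can carry the Hilbert space
structure (the instances that Mathlib puts on `⨂` come with another norm). -/
def HilbertPower (n : ℕ) : Type _ := ⨂[ℂ] _ : Fin n, H

instance (n : ℕ) : AddCommGroup (HilbertPower H n) :=
  inferInstanceAs (AddCommGroup (⨂[ℂ] _ : Fin n, H))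

instance (n : ℕ) : Module ℂ (HilbertPower H n) :=
  inferInstanceAs (Module ℂ (⨂[ℂ] _ : Fin n, H))

variable {H} in
/-- The elementary tensor `x 0 ⊗ ⋯ ⊗ x (n - 1)`. -/
def pureTensor {n : ℕ} (x : Fin n → H) : HilbertPower H n :=
  PiTensorProduct.tprod ℂ x

variable {H} in
/-- The tensor power `A ⊗ ⋯ ⊗ A` (`n` factors) of an operator on `H`. -/
def opPower (A : H →L[ℂ] H) (n : ℕ) : HilbertPower H n →ₗ[ℂ] HilbertPower H n :=
  PiTensorProduct.map (fun _ : Fin n => (A : H →ₗ[ℂ] H))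

variable {H} in
theorem opPower_pureTensor (A : H →L[ℂ] H) (n : ℕ) (x : Fin n → H) :
    opPower A n (pureTensor x) = pureTensor fun i => A (x i) :=
  PiTensorProduct.map_tprod _ _

variable [FiniteDimensional ℂ H]

/-- The basis of elementary tensors `e_{p 0} ⊗ ⋯ ⊗ e_{p (n - 1)}` built from an orthonormal basis
of `H`. -/
def powerBasis (n : ℕ) :
    Module.Basis (Fin n → Fin (Module.finrank ℂ H)) ℂ (HilbertPower H n) :=
  Basis.piTensorProduct (R := ℂ) (M := fun _ : Fin n => H)
    (fun _ : Fin n => (stdOrthonormalBasis ℂ H).toBasis)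

/-- Coordinates with respect to `powerBasis`. -/
def powerCoords (n : ℕ) :
    HilbertPower H n ≃ₗ[ℂ] EuclideanSpace ℂ (Fin n → Fin (Module.finrank ℂ H)) :=
  (powerBasis H n).equivFun ≪≫ₗ (WithLp.linearEquiv 2 ℂ _).symm

/-- The inner product for which `powerBasis` is orthonormal. By `inner_pureTensor` below it is the
usual one of the tensor power, whatever the orthonormal basis of `H`. -/
@[reducible]
def powerCore (n : ℕ) : InnerProductSpace.Core ℂ (HilbertPower H n) where
  inner x y := inner ℂ (powerCoords H n x) (powerCoords H n y)
  conj_inner_symm x y := inner_conj_symm _ _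
  re_inner_nonneg x := inner_self_nonneg
  add_left x y z := by simp only [map_add, inner_add_left]
  smul_left x y r := by simp only [map_smul, inner_smul_left]
  definite x h := by
    have h0 : powerCoords H n x = 0 := inner_self_eq_zero.mp h
    exact (LinearEquiv.map_eq_zero_iff _).mp h0

instance (n : ℕ) : NormedAddCommGroup (HilbertPower H n) :=
  (powerCore H n).toNormedAddCommGroup

instance (n : ℕ) : InnerProductSpace ℂ (HilbertPower H n) :=
  InnerProductSpace.ofCore (powerCore H n).toCore

instance (n : ℕ) : FiniteDimensional ℂ (HilbertPower H n) :=
  (powerBasis H n).finiteDimensional_of_finite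

variable {H}

theorem inner_def {n : ℕ} (x y : HilbertPower H n) :
    inner ℂ x y = inner ℂ (powerCoords H n x) (powerCoords H n y) := rfl

/-- The inner product of the tensor power is multiplicative on elementary tensors. -/
theorem inner_pureTensor {n : ℕ} (x y : Fin n → H) :
    inner ℂ (pureTensor x) (pureTensor y) = ∏ i, inner ℂ (x i) (y i) := by
  have hc : ∀ (z : Fin n → H) (p : Fin n → Fin (Module.finrank ℂ H)),
      powerCoords H n (pureTensor z) p = ∏ i, inner ℂ (stdOrthonormalBasis ℂ H (p i)) (z i) := by
    intro z p
    have h := Basis.piTensorProduct_repr_tprod_apply (R := ℂ) (M := fun _ : Fin n => H)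
      (fun _ : Fin n => (stdOrthonormalBasis ℂ H).toBasis) z p
    simp only [OrthonormalBasis.coe_toBasis_repr_apply, OrthonormalBasis.repr_apply_apply] at h
    exact h
  rw [inner_def, PiLp.inner_apply]
  simp only [hc, RCLike.inner_apply, map_prod, inner_conj_symm]
  simp only [← Finset.prod_mul_distrib]
  rw [← Fintype.prod_sum (fun i j => inner ℂ (stdOrthonormalBasis ℂ H j) (y i) *
    inner ℂ (x i) (stdOrthonormalBasis ℂ H j))]
  refine Finset.prod_congr rfl fun i _ => ?_
  rw [← (stdOrthonormalBasis ℂ H).sum_inner_mul_inner (x i) (y i)]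
  exact Finset.sum_congr rfl fun j _ => mul_comm _ _

/-- The number `Tr (A^{⊗n} X)`. For positive semi-definite `A` and `X` the trace is a non-negative
real, so that taking the real part only changes the type. -/
def powTr (A : H →L[ℂ] H) (n : ℕ) (X : HilbertPower H n →ₗ[ℂ] HilbertPower H n) : ℝ :=
  (LinearMap.trace ℂ (HilbertPower H n) (opPower A n ∘ₗ X)).re

/-- The weighted geometric mean `B^{1/2} (B^{-1/2} A B^{-1/2})^t B^{1/2}` of positive definite
operators; the powers are those of the continuous functional calculus. -/
def geomMean [CompleteSpace H] (t : ℝ) (B A : H →L[ℂ] H) : H →L[ℂ] H :=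
  B ^ (1 / 2 : ℝ) * (B ^ (-1 / 2 : ℝ) * A * B ^ (-1 / 2 : ℝ)) ^ t * B ^ (1 / 2 : ℝ)

/-- `G` is the `t`-weighted Kubo-Ando geometric mean `B #_t A` of the positive semi-definite
operators `B` and `A`: the limit of the means of `B + ε I` and `A + ε I` as `ε ↘ 0`. -/
def IsKuboAndoMean [CompleteSpace H] (t : ℝ) (B A G : H →L[ℂ] H) : Prop :=
  Tendsto (fun ε : ℝ => geomMean t (B + (ε : ℂ) • 1) (A + (ε : ℂ) • 1)) (𝓝[>] 0) (𝓝 G)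

end KuboAndoPowers

end

open KuboAndoPowers

/-!
Two positive operators are simultaneously diagonalized by a congruence, `A₁ = ∑ i, α i |v i⟩⟨v i|`
and `A₂ = ∑ i, β i |v i⟩⟨v i|` for a basis `v` that need not be orthogonal, and then
`A₂ #_t A₁ = ∑ i, (α i) ^ t * (β i) ^ (1 - t) |v i⟩⟨v i|`. The bounds that follow from (v) are
therefore the weighted arithmetic-geometric mean inequality and Hölder's inequality for the
coefficients.

Conversely, each condition bounds `⟨z, C^{⊗n} z⟩` by `r n * max ⟨z, A₁^{⊗n} z⟩ ⟨z, A₂^{⊗n} z⟩` with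
`r` subexponential, and `r` disappears on replacing `z` by its tensor powers. The triples
`(⟨z, A₁^{⊗n} z⟩, ⟨z, A₂^{⊗n} z⟩, ⟨z, C^{⊗n} z⟩)` form a multiplicative semigroup, which forces a
single `t` with `⟨z, C^{⊗n} z⟩ ≤ ⟨z, A₁^{⊗n} z⟩ ^ t * ⟨z, A₂^{⊗n} z⟩ ^ (1 - t)` for all `z`. Finally
`x^{⊗n}` is a sum of at most `(n + 1) ^ dim H` components, one per type of words, on each of which
`A₁^{⊗n}` and `A₂^{⊗n}` have the same quadratic form up to scalars; there the right-hand side is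
the quadratic form of `(A₂ #_t A₁)^{⊗n}`, and taking `n`-th roots gives `C ≤ A₂ #_t A₁`.
-/

noncomputable section

namespace KuboAndoPowers

open InnerProductSpace

section DiagOp

variable {H : Type*} [NormedAddCommGroup H] [InnerProductSpace ℂ H] {ι : Type*} [Fintype ι]

/-- The operator `∑ i, α i |v i⟩⟨v i|`. The family `v` need not be orthogonal: two positive
operators are simultaneously of this form for some basis `v`, but in general not for an
orthonormal one. -/
def diagOp (v : ι → H) (α : ι → ℝ) : H →L[ℂ] H :=
  ∑ i, (α i : ℂ) • rankOne ℂ (v i) (v i)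

theorem diagOp_apply (v : ι → H) (α : ι → ℝ) (x : H) :
    diagOp v α x = ∑ i, (α i : ℂ) • inner ℂ (v i) x • v i := by
  simp [diagOp, rankOne_apply]

theorem inner_diagOp_self (v : ι → H) (α : ι → ℝ) (x : H) :
    inner ℂ x (diagOp v α x) = ((∑ i, α i * ‖inner ℂ (v i) x‖ ^ 2 : ℝ) : ℂ) := by
  rw [diagOp_apply, inner_sum]
  push_cast
  refine Finset.sum_congr rfl fun i _ => ?_
  rw [inner_smul_right, inner_smul_right, ← inner_conj_symm x (v i), Complex.mul_conj']

theorem diagOp_add (v : ι → H) (α β : ι → ℝ) :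
    diagOp v (α + β) = diagOp v α + diagOp v β := by
  simp [diagOp, add_smul, Finset.sum_add_distrib]

theorem diagOp_smul (v : ι → H) (c : ℝ) (α : ι → ℝ) :
    diagOp v (c • α) = (c : ℂ) • diagOp v α := by
  simp [diagOp, mul_smul, Finset.smul_sum]

theorem diagOp_sub (v : ι → H) (α β : ι → ℝ) :
    diagOp v (α - β) = diagOp v α - diagOp v β := by
  simp [diagOp, sub_smul, Finset.sum_sub_distrib]

theorem diagOp_ofReal_smul (c : ι → ℝ) (v : ι → H) (α : ι → ℝ) :
    diagOp (fun i => (c i : ℂ) • v i) α = diagOp v (c ^ 2 * α) := by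
  ext x
  simp only [diagOp_apply, inner_smul_left, smul_smul, Complex.conj_ofReal, Pi.mul_apply,
    Pi.pow_apply]
  refine Finset.sum_congr rfl fun i _ => congrArg (· • v i) ?_
  push_cast
  ring

theorem diagOp_nonneg (v : ι → H) {α : ι → ℝ} (hα : 0 ≤ α) : 0 ≤ diagOp v α := by
  rw [ContinuousLinearMap.nonneg_iff_isPositive]
  exact ContinuousLinearMap.isPositive_sum _ fun i _ =>
    (isPositive_rankOne_self (v i)).smul_of_nonneg (by exact_mod_cast hα i)

theorem diagOp_mono (v : ι → H) {α β : ι → ℝ} (h : α ≤ β) : diagOp v α ≤ diagOp v β := by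
  rw [ContinuousLinearMap.le_def, ← diagOp_sub, ← ContinuousLinearMap.nonneg_iff_isPositive]
  exact diagOp_nonneg v (sub_nonneg.2 h)

theorem mul_diagOp_mul_star [CompleteSpace H] (T : H →L[ℂ] H) (v : ι → H) (α : ι → ℝ) :
    T * diagOp v α * star T = diagOp (fun i => T (v i)) α := by
  ext x
  simp [diagOp_apply, ContinuousLinearMap.star_eq_adjoint, ContinuousLinearMap.adjoint_inner_right]

theorem eq_diagOp_of_apply_eq (u : OrthonormalBasis ι ℂ H) {T : H →L[ℂ] H} {α : ι → ℝ}
    (h : ∀ i, T (u i) = (α i : ℂ) • u i) : T = diagOp u α := by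
  ext x
  conv_lhs => rw [← u.sum_repr' x]
  simp only [map_sum, map_smul, h, diagOp_apply, smul_comm (inner ℂ _ x)]

theorem diagOp_one (u : OrthonormalBasis ι ℂ H) : diagOp u 1 = 1 :=
  (eq_diagOp_of_apply_eq u (by simp)).symm

end DiagOp

section DualFamily

variable {H : Type*} [NormedAddCommGroup H] [InnerProductSpace ℂ H] {ι : Type*}

open scoped Classical in
theorem sum_inner_smul_eq [Fintype ι] (v : Module.Basis ι ℂ H) {w : ι → H}
    (hw : ∀ i j, inner ℂ (v i) (w j) = if i = j then 1 else 0) (x : H) :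
    ∑ i, inner ℂ (v i) x • w i = x :=
  ext_inner_left_basis v fun j => by simp [inner_sum, inner_smul_right, hw]

variable [FiniteDimensional ℂ H]

open scoped Classical in
theorem exists_inner_eq_ite (v : Module.Basis ι ℂ H) :
    ∃ w : ι → H, ∀ i j, inner ℂ (v i) (w j) = if i = j then 1 else 0 := by
  have := FiniteDimensional.complete ℂ H
  refine ⟨fun j => (toDual ℂ H).symm (v.coord j).toContinuousLinearMap, fun i j => ?_⟩
  rw [← inner_conj_symm, toDual_symm_apply]
  simp [Finsupp.single_apply, apply_ite]

variable [Fintype ι]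

theorem diagOp_nonneg_iff (v : Module.Basis ι ℂ H) {α : ι → ℝ} : 0 ≤ diagOp v α ↔ 0 ≤ α := by
  classical
  refine ⟨fun h j => ?_, diagOp_nonneg v⟩
  obtain ⟨w, hw⟩ := exists_inner_eq_ite v
  have := ((ContinuousLinearMap.nonneg_iff_isPositive _).1 h).re_inner_nonneg_right (w j)
  simpa [inner_diagOp_self, hw, apply_ite] using this

theorem diagOp_isStrictlyPositive [CompleteSpace H] (v : Module.Basis ι ℂ H) {α : ι → ℝ}
    (hα : ∀ i, 0 < α i) : IsStrictlyPositive (diagOp v α) := by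
  rw [IsStrictlyPositive.iff_of_unital]
  refine ⟨diagOp_nonneg v fun i => (hα i).le, ?_⟩
  rw [ContinuousLinearMap.isUnit_iff_isUnit_toLinearMap, LinearMap.isUnit_iff_ker_eq_bot,
    LinearMap.ker_eq_bot']
  intro x (hx : diagOp v α x = 0)
  have hsum : ∑ i, α i * ‖inner ℂ (v i) x‖ ^ 2 = 0 := by
    rw [← Complex.ofReal_eq_zero, ← inner_diagOp_self, hx, inner_zero_right]
  rw [Finset.sum_eq_zero_iff_of_nonneg fun i _ => mul_nonneg (hα i).le (sq_nonneg _)] at hsum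
  refine ext_inner_left_basis v fun i => ?_
  simpa [(hα i).ne'] using hsum i (Finset.mem_univ i)

theorem exists_isUnit_map_orthonormalBasis (v : Module.Basis ι ℂ H) :
    ∃ (u : OrthonormalBasis ι ℂ H) (T : H →L[ℂ] H), IsUnit T ∧ ∀ i, T (u i) = v i := by
  let u : OrthonormalBasis ι ℂ H := (stdOrthonormalBasis ℂ H).reindex
    (Fintype.equivOfCardEq (by simp [Module.finrank_eq_card_basis v]))
  let T : H ≃L[ℂ] H := (u.toBasis.equiv v (Equiv.refl ι)).toContinuousLinearEquiv
  refine ⟨u, T, ⟨ContinuousLinearEquiv.toUnit T, rfl⟩, fun i => ?_⟩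
  simpa using! u.toBasis.equiv_apply i v (Equiv.refl ι)

end DualFamily

section Rpow

variable {H : Type*} [NormedAddCommGroup H] [InnerProductSpace ℂ H] [CompleteSpace H]
  {ι : Type*} [Fintype ι]

/-- The star homomorphism that sends `c` to the operator with eigenbasis `u` and eigenvalues `c`.
It carries the functional calculus of `ι → ℂ` to that of the operators. -/
def diagHom (u : OrthonormalBasis ι ℂ H) : (ι → ℂ) →⋆ₐ[ℂ] (H →L[ℂ] H) where
  toFun c := ∑ i, c i • rankOne ℂ (u i) (u i)
  map_one' := by
    simp only [Pi.one_apply, one_smul, u.sum_rankOne_eq_id]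
    rfl
  map_zero' := by simp
  map_add' a b := by simp [add_smul, Finset.sum_add_distrib]
  commutes' r := by
    simp only [Pi.algebraMap_apply, Algebra.algebraMap_self, RingHom.id_apply, ← Finset.smul_sum,
      u.sum_rankOne_eq_id, Algebra.algebraMap_eq_smul_one]
    rfl
  map_mul' a b := by
    classical
    simp [Finset.sum_mul_sum, ContinuousLinearMap.mul_def, rankOne_comp_rankOne, u.inner_eq_ite,
      ite_smul, smul_smul, mul_comm]
  map_star' a := by
    simp [star_sum, ContinuousLinearMap.star_eq_adjoint]

theorem diagHom_ofReal (u : OrthonormalBasis ι ℂ H) (α : ι → ℝ) :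
    diagHom u (fun i => (α i : ℂ)) = diagOp u α := rfl

theorem rpow_diagOp (u : OrthonormalBasis ι ℂ H) {α : ι → ℝ} (hα : 0 ≤ α) {t : ℝ} (ht : 0 ≤ t) :
    diagOp u α ^ t = diagOp u (fun i => α i ^ t) := by
  have hpow : Continuous fun z : ℂ => ((z.re ^ t : ℝ) : ℂ) :=
    Complex.continuous_ofReal.comp ((Real.continuous_rpow_const ht).comp Complex.continuous_re)
  have hdiag : Continuous (diagHom u) := by
    change Continuous fun c : ι → ℂ => ∑ i, c i • rankOne ℂ (u i) (u i)
    fun_prop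
  have hpos := diagOp_nonneg u hα
  rw [CFC.rpow_eq_cfc_real hpos, cfc_real_eq_complex _ hpos.isSelfAdjoint, ← diagHom_ofReal,
    ← (diagHom u).map_cfc _ _ hpow.continuousOn hdiag,
    cfc_map_pi (S := ℂ) _ (fun i => (α i : ℂ)) hpow.continuousOn, ← diagHom_ofReal]
  exact congrArg (diagHom u) (funext fun i => cfc_algebraMap (α i : ℂ) _)

end Rpow

section GeomMean

theorem rpow_mul_mul_star {A : Type*} [CStarAlgebra A] [PartialOrder A] [StarOrderedRing A]
    {K : A} (hK : 0 ≤ K) (U : unitary A) {t : ℝ} (ht : 0 ≤ t) :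
    ((U : A) * K * star (U : A)) ^ t = U * K ^ t * star (U : A) := by
  have hpow : Continuous fun x : ℝ => x ^ t := Real.continuous_rpow_const ht
  have hconj : Continuous (Unitary.conjStarAlgAut ℝ A U) := by
    change Continuous fun a : A => (U : A) * a * star (U : A)
    fun_prop
  rw [CFC.rpow_eq_cfc_real hK, CFC.rpow_eq_cfc_real (star_right_conjugate_nonneg hK _)]
  exact (StarAlgHomClass.map_cfc (Unitary.conjStarAlgAut ℝ A U) _ K hpow.continuousOn hconj
    hK.isSelfAdjoint (hK.isSelfAdjoint.map _)).symm

variable {H : Type*} [NormedAddCommGroup H] [InnerProductSpace ℂ H] [CompleteSpace H]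

/-- Writing `T = B^{1/2} U` with `B = T T⋆` and `U` unitary reduces this to unitary invariance of
the functional calculus. -/
theorem geomMean_mul_star {T K : H →L[ℂ] H} (hT : IsUnit T) (hK : 0 ≤ K) {t : ℝ} (ht : 0 ≤ t) :
    geomMean t (T * star T) (T * K * star T) = T * K ^ t * star T := by
  have hB : IsStrictlyPositive (T * star T) :=
    (hT.mul hT.star).isStrictlyPositive (mul_star_self_nonneg T)
  have hDBD := CFC.conjugate_rpow_neg_one_half (T * star T) hB
  have hRD := CFC.rpow_mul_rpow_neg (1 / 2) hB
  have hDR := CFC.rpow_neg_mul_rpow (1 / 2) hB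
  have hD : IsSelfAdjoint ((T * star T) ^ (-(1 / 2) : ℝ)) := CFC.rpow_nonneg.isSelfAdjoint
  rw [geomMean, neg_div]
  set R := (T * star T) ^ (1 / 2 : ℝ)
  set D := (T * star T) ^ (-(1 / 2) : ℝ)
  have hstar : star (D * T) = star T * D := by rw [star_mul, hD.star_eq]
  have hU : D * T ∈ unitary (H →L[ℂ] H) := by
    refine IsUnit.mem_unitary_of_mul_star_self ((hB.isUnit.cfcRpow _ hB.nonneg).mul hT) ?_
    rw [hstar, ← hDBD]; simp only [mul_assoc]
  have hUKU : D * (T * K * star T) * D = D * T * K * star (D * T) := by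
    rw [hstar]; simp only [mul_assoc]
  rw [hUKU, rpow_mul_mul_star hK ⟨D * T, hU⟩ ht]
  calc R * (D * T * K ^ t * star (D * T)) * R
      = (R * D) * (T * K ^ t * star T) * (D * R) := by rw [hstar]; simp only [mul_assoc]
    _ = T * K ^ t * star T := by rw [hRD, hDR, one_mul, mul_one]

theorem geomMean_comm {A B : H →L[ℂ] H} (hA : IsStrictlyPositive A) (hB : IsStrictlyPositive B)
    {t : ℝ} (ht : t ≤ 1) : geomMean t B A = geomMean (1 - t) A B := by
  have hRD := CFC.rpow_mul_rpow_neg (1 / 2) hB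
  have hDR := CFC.rpow_neg_mul_rpow (1 / 2) hB
  have hRR : B ^ (1 / 2 : ℝ) * B ^ (1 / 2 : ℝ) = B := by
    rw [← CFC.sqrt_eq_rpow, CFC.sqrt_mul_sqrt_self B hB.nonneg]
  have hR : IsSelfAdjoint (B ^ (1 / 2 : ℝ)) := CFC.rpow_nonneg.isSelfAdjoint
  have hD : IsSelfAdjoint (B ^ (-(1 / 2) : ℝ)) := CFC.rpow_nonneg.isSelfAdjoint
  rw [geomMean, neg_div]
  set R := B ^ (1 / 2 : ℝ)
  set D := B ^ (-(1 / 2) : ℝ)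
  have hK : IsStrictlyPositive (D * A * D) :=
    IsStrictlyPositive.conjugate_of_isUnit_of_isSelfAdjoint A D
      (hB.isUnit.cfcRpow _ hB.nonneg) hD hA
  have hRKR : R * (D * A * D) * R = A := by
    rw [← mul_assoc, ← mul_assoc, hRD, one_mul, mul_assoc, hDR, mul_one]
  set K := D * A * D
  have hS : IsSelfAdjoint (K ^ (1 / 2 : ℝ)) := CFC.rpow_nonneg.isSelfAdjoint
  set T := R * K ^ (1 / 2 : ℝ) with hT
  have hTu : IsUnit T :=
    (hB.isUnit.cfcRpow _ hB.nonneg).mul (hK.isUnit.cfcRpow _ hK.nonneg)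
  have hconj (s : ℝ) : T * K ^ s * star T = R * K ^ (1 + s) * R := by
    rw [show 1 + s = 1 / 2 + s + 1 / 2 by ring, CFC.rpow_add hK.isUnit, CFC.rpow_add hK.isUnit,
      hT, star_mul, hR.star_eq, hS.star_eq]
    simp only [mul_assoc]
  have hTA : A = T * star T := by
    simpa only [CFC.rpow_zero K hK.nonneg, add_zero, CFC.rpow_one K hK.nonneg, mul_one, hRKR]
      using (hconj 0).symm
  have hTB : B = T * K ^ (-1 : ℝ) * star T := by
    rw [hconj, add_neg_cancel, CFC.rpow_zero K hK.nonneg, mul_one, hRR]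
  calc R * K ^ t * R = T * (K ^ (-1 : ℝ)) ^ (1 - t) * star T := by
        rw [CFC.rpow_rpow K _ _ (by norm_num) hK, hconj]; ring_nf
    _ = geomMean (1 - t) A B := by
        rw [← geomMean_mul_star hTu CFC.rpow_nonneg (sub_nonneg.2 ht), ← hTA, ← hTB]

theorem geomMean_mono_right (B : H →L[ℂ] H) {A A' : H →L[ℂ] H} (h : A ≤ A')
    {t : ℝ} (ht : t ∈ Icc 0 1) :
    geomMean t B A ≤ geomMean t B A' := by
  have hR : IsSelfAdjoint (B ^ (1 / 2 : ℝ)) := CFC.rpow_nonneg.isSelfAdjoint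
  have hD : IsSelfAdjoint (B ^ (-1 / 2 : ℝ)) := CFC.rpow_nonneg.isSelfAdjoint
  exact hR.conjugate_le_conjugate (CFC.rpow_le_rpow ht (hD.conjugate_le_conjugate h))

theorem geomMean_mono {A A' B B' : H →L[ℂ] H} (hA : IsStrictlyPositive A)
    (hB : IsStrictlyPositive B) (hAA' : A ≤ A') (hBB' : B ≤ B') {t : ℝ} (ht : t ∈ Icc 0 1) :
    geomMean t B A ≤ geomMean t B' A' := by
  have hA' := hA.of_le hAA'
  calc geomMean t B A ≤ geomMean t B A' := geomMean_mono_right B hAA' ht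
    _ = geomMean (1 - t) A' B := geomMean_comm hA' hB ht.2
    _ ≤ geomMean (1 - t) A' B' :=
      geomMean_mono_right A' hBB' ⟨sub_nonneg.2 ht.2, sub_le_self 1 ht.1⟩
    _ = geomMean t B' A' := (geomMean_comm hA' (hB.of_le hBB') ht.2).symm

theorem geomMean_diagOp [FiniteDimensional ℂ H] {ι : Type*} [Fintype ι] (v : Module.Basis ι ℂ H)
    {α β : ι → ℝ} (hα : ∀ i, 0 ≤ α i) (hβ : ∀ i, 0 < β i) {t : ℝ} (ht : 0 ≤ t) :
    geomMean t (diagOp v β) (diagOp v α) = diagOp v (fun i => α i ^ t * β i ^ (1 - t)) := by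
  have hsqrt (i : ι) : IsUnit ((√(β i) : ℝ) : ℂ) := by
    simpa using (Real.sqrt_pos.2 (hβ i)).ne'
  obtain ⟨u, T, hT, hTu⟩ := exists_isUnit_map_orthonormalBasis (v.isUnitSMul hsqrt)
  have hconj (κ : ι → ℝ) : T * diagOp u κ * star T = diagOp v (β * κ) := by
    simp only [mul_diagOp_mul_star, hTu, Module.Basis.isUnitSMul_apply]
    rw [diagOp_ofReal_smul]
    congr 2
    ext i
    exact Real.sq_sqrt (hβ i).le
  have hTT : T * star T = diagOp v β := by simpa [diagOp_one] using hconj 1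
  have hα' : β * (α / β) = α := by ext i; exact mul_div_cancel₀ _ (hβ i).ne'
  have hκ : 0 ≤ α / β := fun i => div_nonneg (hα i) (hβ i).le
  calc geomMean t (diagOp v β) (diagOp v α)
      = geomMean t (T * star T) (T * diagOp u (α / β) * star T) := by
        rw [hconj, hα', hTT]
    _ = T * diagOp u (α / β) ^ t * star T := geomMean_mul_star hT (diagOp_nonneg u hκ) ht
    _ = diagOp v (fun i => α i ^ t * β i ^ (1 - t)) := by
        rw [rpow_diagOp u hκ ht, hconj]
        congr 1
        ext i
        rw [Pi.mul_apply, Pi.div_apply, Real.div_rpow (hα i) (hβ i).le, Real.rpow_sub (hβ i),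
          Real.rpow_one]
        ring

end GeomMean

section SimultaneousDiagonalization

theorem mul_eq_zero_of_add_mul_eq_zero {A : Type*} [CStarAlgebra A] [PartialOrder A]
    [StarOrderedRing A] {a b q : A} (ha : 0 ≤ a) (hb : 0 ≤ b) (h : (a + b) * q = 0) :
    a * q = 0 := by
  have hqaq : star q * a * q = 0 := by
    refine ((add_eq_zero_iff_of_nonneg (star_left_conjugate_nonneg ha q)
      (star_left_conjugate_nonneg hb q)).1 ?_).1
    rw [← add_mul, ← mul_add, mul_assoc, h, mul_zero]
  have hsqrt : CFC.sqrt a * q = 0 := by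
    rw [← CStarRing.star_mul_self_eq_zero_iff, star_mul, (CFC.sqrt_nonneg a).star_eq, mul_assoc,
      ← mul_assoc _ _ q, CFC.sqrt_mul_sqrt_self a ha, ← mul_assoc, hqaq]
  rw [← CFC.sqrt_mul_sqrt_self a ha, mul_assoc, hsqrt, mul_zero]

variable {H : Type*} [NormedAddCommGroup H] [InnerProductSpace ℂ H]

theorem apply_eq_re_smul_of_apply_eq_smul {T : H →ₗ[ℂ] H} (hT : T.IsSymmetric) {μ : ℂ} {x : H}
    (hx : T x = μ • x) : T x = (μ.re : ℂ) • x := by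
  rcases eq_or_ne x 0 with rfl | hx0
  · simp
  · have hμ : Module.End.HasEigenvalue T μ :=
      Module.End.hasEigenvalue_of_hasEigenvector ⟨Module.End.mem_eigenspace_iff.2 hx, hx0⟩
    rw [hx, Complex.conj_eq_iff_re.1 (hT.conj_eigenvalue_eq_self hμ)]

variable [FiniteDimensional ℂ H]

theorem exists_diagOp_of_commute {A B : H →L[ℂ] H} (hA : (A : H →ₗ[ℂ] H).IsSymmetric)
    (hB : (B : H →ₗ[ℂ] H).IsSymmetric) (hAB : Commute A B) :
    ∃ (u : OrthonormalBasis (Fin (Module.finrank ℂ H)) ℂ H) (α β : Fin (Module.finrank ℂ H) → ℝ),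
      A = diagOp u α ∧ B = diagOp u β := by
  classical
  let V : ℂ × ℂ → Submodule ℂ H := fun μ =>
    Module.End.eigenspace (A : H →ₗ[ℂ] H) μ.2 ⊓ Module.End.eigenspace (B : H →ₗ[ℂ] H) μ.1
  have hAB' : Commute (A : H →ₗ[ℂ] H) (B : H →ₗ[ℂ] H) :=
    hAB.map ContinuousLinearMap.toLinearMapRingHom
  have hV : DirectSum.IsInternal V :=
    LinearMap.IsSymmetric.directSum_isInternal_of_commute hA hB hAB'
  have hV' := DirectSum.isInternal_ne_bot_iff.2 hV
  have hortho := (LinearMap.IsSymmetric.orthogonalFamily_eigenspace_inf_eigenspace hA hB).comp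
    (Subtype.val_injective (p := fun μ => V μ ≠ ⊥))
  have : Fintype {μ // V μ ≠ ⊥} := hV.submodule_iSupIndep.fintypeNeBotOfFiniteDimensional
  let u := hV'.subordinateOrthonormalBasis rfl hortho
  let μ i := hV'.subordinateOrthonormalBasisIndex rfl i hortho
  have hu (i) : u i ∈ V (μ i) := hV'.subordinateOrthonormalBasis_subordinate rfl i hortho
  exact ⟨u, fun i => (μ i).1.2.re, fun i => (μ i).1.1.re,
    eq_diagOp_of_apply_eq u fun i => apply_eq_re_smul_of_apply_eq_smul hA
      (Module.End.mem_eigenspace_iff.1 (hu i).1),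
    eq_diagOp_of_apply_eq u fun i => apply_eq_re_smul_of_apply_eq_smul hB
      (Module.End.mem_eigenspace_iff.1 (hu i).2)⟩

theorem mul_mul_comm_of_add_add_inverse {R : Type*} [Ring R] {a b q p : R}
    (hl : p * (a + b + q) = 1) (hr : (a + b + q) * p = 1) (hq : q * q = q) (haq : a * q = 0)
    (hbq : b * q = 0) (hqa : q * a = 0) (hqb : q * b = 0) : a * p * b = b * p * a := by
  have hpq : p * q = q := by
    calc p * q = p * ((a + b + q) * q) := by rw [add_mul, add_mul, haq, hbq, hq, zero_add, zero_add]
      _ = q := by rw [← mul_assoc, hl, one_mul]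
  have hqp : q * p = q := by
    calc q * p = q * (a + b + q) * p := by rw [mul_add, mul_add, hqa, hqb, hq, zero_add, zero_add]
      _ = q := by rw [mul_assoc, hr, mul_one]
  have h₁ : a = a * p * a + a * p * b := by
    calc a = a * (p * (a + b + q)) := by rw [hl, mul_one]
      _ = a * p * a + a * p * b + a * (p * q) := by noncomm_ring
      _ = a * p * a + a * p * b := by rw [hpq, haq, add_zero]
  have h₂ : a = a * p * a + b * p * a := by
    calc a = (a + b + q) * p * a := by rw [hr, one_mul]
      _ = a * p * a + b * p * a + q * p * a := by noncomm_ring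
      _ = a * p * a + b * p * a := by rw [hqp, hqa, add_zero]
  exact add_left_cancel (h₁.symm.trans h₂)

variable [CompleteSpace H]

theorem exists_isStarProjection_isUnit_add {A B : H →L[ℂ] H} (hA : 0 ≤ A) (hB : 0 ≤ B) :
    ∃ Q : H →L[ℂ] H, IsStarProjection Q ∧ A * Q = 0 ∧ B * Q = 0 ∧ IsUnit (A + B + Q) := by
  let K := LinearMap.ker (A + B : H →L[ℂ] H).toLinearMap
  let Q : H →L[ℂ] H := K.starProjection
  have hQ : IsStarProjection Q := isStarProjection_starProjection
  have hABQ : (A + B) * Q = 0 := by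
    ext x
    exact K.starProjection_apply_mem x
  have hQAB : Q * (A + B) = 0 := by
    simpa [(add_nonneg hA hB).star_eq, hQ.isSelfAdjoint.star_eq] using congrArg star hABQ
  refine ⟨Q, hQ, mul_eq_zero_of_add_mul_eq_zero hA hB hABQ,
    mul_eq_zero_of_add_mul_eq_zero hB hA (by rwa [add_comm]), ?_⟩
  rw [ContinuousLinearMap.isUnit_iff_isUnit_toLinearMap, LinearMap.isUnit_iff_ker_eq_bot,
    LinearMap.ker_eq_bot']
  intro x (hx : (A + B + Q) x = 0)
  have hQx : Q x = 0 := by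
    calc Q x = (Q * (A + B + Q)) x := by rw [mul_add, hQAB, zero_add, hQ.isIdempotentElem]
      _ = 0 := by rw [mul_apply_eq_comp, hx, map_zero]
  have hxK : x ∈ K := by
    change A x + B x = 0
    simpa [hQx] using hx
  rw [← hQx, Submodule.starProjection_eq_self_iff.2 hxK]

theorem exists_inverse_commute_conj {A B : H →L[ℂ] H} (hA : 0 ≤ A) (hB : 0 ≤ B) :
    ∃ R D : H →L[ℂ] H, R * D = 1 ∧ D * R = 1 ∧ IsSelfAdjoint R ∧ IsSelfAdjoint D ∧
      Commute (D * A * D) (D * B * D) := by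
  obtain ⟨Q, hQ, hAQ, hBQ, hunit⟩ := exists_isStarProjection_isUnit_add hA hB
  have hS : IsStrictlyPositive (A + B + Q) :=
    hunit.isStrictlyPositive (add_nonneg (add_nonneg hA hB) hQ.nonneg)
  have hQA : Q * A = 0 := by
    simpa [hA.star_eq, hQ.isSelfAdjoint.star_eq] using congrArg star hAQ
  have hQB : Q * B = 0 := by
    simpa [hB.star_eq, hQ.isSelfAdjoint.star_eq] using congrArg star hBQ
  have hAB : A * (A + B + Q) ^ (-1 : ℝ) * B = B * (A + B + Q) ^ (-1 : ℝ) * A := by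
    refine mul_mul_comm_of_add_add_inverse ?_ ?_ hQ.isIdempotentElem hAQ hBQ hQA hQB
    · simpa [CFC.rpow_one _ hS.nonneg] using CFC.rpow_neg_mul_rpow 1 hS
    · simpa [CFC.rpow_one _ hS.nonneg] using CFC.rpow_mul_rpow_neg 1 hS
  refine ⟨(A + B + Q) ^ (1 / 2 : ℝ), (A + B + Q) ^ (-(1 / 2) : ℝ), CFC.rpow_mul_rpow_neg _ hS,
    CFC.rpow_neg_mul_rpow _ hS, CFC.rpow_nonneg.isSelfAdjoint, CFC.rpow_nonneg.isSelfAdjoint, ?_⟩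
  have hDD : (A + B + Q) ^ (-(1 / 2) : ℝ) * (A + B + Q) ^ (-(1 / 2) : ℝ) =
      (A + B + Q) ^ (-1 : ℝ) := by
    rw [← CFC.rpow_add hunit]
    norm_num
  set D := (A + B + Q) ^ (-(1 / 2) : ℝ)
  calc D * A * D * (D * B * D) = D * (A * (D * D) * B) * D := by simp only [mul_assoc]
    _ = D * (B * (D * D) * A) * D := by rw [hDD, hAB]
    _ = D * B * D * (D * A * D) := by simp only [mul_assoc]

theorem exists_simultaneous_diagOp {A B : H →L[ℂ] H} (hA : 0 ≤ A) (hB : 0 ≤ B) :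
    ∃ (v : Module.Basis (Fin (Module.finrank ℂ H)) ℂ H) (α β : Fin (Module.finrank ℂ H) → ℝ),
      0 ≤ α ∧ 0 ≤ β ∧ A = diagOp v α ∧ B = diagOp v β := by
  obtain ⟨R, D, hRD, hDR, hR, hD, hcomm⟩ := exists_inverse_commute_conj hA hB
  have hsymm {T : H →L[ℂ] H} (hT : 0 ≤ T) : (D * T * D : H →L[ℂ] H).toLinearMap.IsSymmetric :=
    (hT.isSelfAdjoint.conjugate_self hD).isSymmetric
  obtain ⟨u, α, β, hα, hβ⟩ := exists_diagOp_of_commute (hsymm hA) (hsymm hB) hcomm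
  let v := u.toBasis.map (ContinuousLinearEquiv.unitsEquiv ℂ H ⟨R, D, hRD, hDR⟩).toLinearEquiv
  have hv {T : H →L[ℂ] H} {γ} (hT : D * T * D = diagOp u γ) : T = diagOp v γ := by
    calc T = R * (D * T * D) * star R := by
          rw [hR.star_eq, ← mul_assoc, ← mul_assoc, hRD, one_mul, mul_assoc, hDR, mul_one]
      _ = diagOp v γ := by rw [hT, mul_diagOp_mul_star]; congr 1
  exact ⟨v, α, β, (diagOp_nonneg_iff v).1 (hv hα ▸ hA), (diagOp_nonneg_iff v).1 (hv hβ ▸ hB),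
    hv hα, hv hβ⟩

end SimultaneousDiagonalization

section KuboAndoMean

theorem exists_pos_smul_le {A : Type*} [CStarAlgebra A] [PartialOrder A] [StarOrderedRing A]
    {a b : A} (ha : IsSelfAdjoint a) (hb : IsStrictlyPositive b) : ∃ c : ℝ, 0 < c ∧ c • a ≤ b := by
  nontriviality A using exists_gt
  obtain ⟨r, hr, hrb⟩ := (CFC.exists_pos_algebraMap_le_iff hb.isSelfAdjoint).2
    fun x hx => hb.spectrum_pos hx
  have hden : 0 < ‖a‖ + 1 := by positivity
  refine ⟨r / (‖a‖ + 1), div_pos hr hden, ?_⟩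
  calc (r / (‖a‖ + 1)) • a ≤ (r / (‖a‖ + 1)) • algebraMap ℝ A (‖a‖ + 1) := by
        refine smul_le_smul_of_nonneg_left ?_ (div_pos hr hden).le
        exact ha.le_algebraMap_norm_self.trans
          (algebraMap_mono A (le_add_of_nonneg_right zero_le_one))
    _ = algebraMap ℝ A r := by
        rw [Algebra.algebraMap_eq_smul_one, Algebra.algebraMap_eq_smul_one, smul_smul,
          div_mul_cancel₀ _ hden.ne']
    _ ≤ b := hrb

theorem tendsto_of_tendsto_of_tendsto_of_le_of_le' {A : Type*} [CStarAlgebra A] [PartialOrder A]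
    [StarOrderedRing A] {X : Type*} {l : Filter X} {f g h : X → A} {a : A}
    (hf : Tendsto f l (𝓝 a)) (hh : Tendsto h l (𝓝 a)) (hfg : ∀ᶠ x in l, f x ≤ g x)
    (hgh : ∀ᶠ x in l, g x ≤ h x) : Tendsto g l (𝓝 a) := by
  have hsub : Tendsto (fun x => g x - f x) l (𝓝 0) := by
    refine squeeze_zero_norm' (a := fun x => ‖h x - f x‖) ?_ (by simpa using (hh.sub hf).norm)
    filter_upwards [hfg, hgh] with x hfg hgh
    exact CStarAlgebra.norm_le_norm_of_nonneg_of_le (sub_nonneg.2 hfg) (sub_le_sub_right hgh _)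
  simpa using hsub.add hf

variable {H : Type*} [NormedAddCommGroup H] [InnerProductSpace ℂ H]

theorem tendsto_diagOp {ι X : Type*} [Fintype ι] (v : ι → H) {l : Filter X} {γ : X → ι → ℝ}
    {γ₀ : ι → ℝ} (h : Tendsto γ l (𝓝 γ₀)) :
    Tendsto (fun x => diagOp v (γ x)) l (𝓝 (diagOp v γ₀)) :=
  tendsto_finsetSum _ fun i _ =>
    ((Complex.continuous_ofReal.tendsto _).comp (tendsto_pi_nhds.1 h i)).smul tendsto_const_nhds

variable [FiniteDimensional ℂ H] [CompleteSpace H]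

theorem exists_diagOp_add_le {ι : Type*} [Fintype ι] (v : Module.Basis ι ℂ H) :
    ∃ c d : ℝ, 0 < c ∧ 0 < d ∧ ∀ (γ : ι → ℝ) {ε : ℝ}, 0 ≤ ε →
      diagOp v (γ + (ε * c) • 1) ≤ diagOp v γ + (ε : ℂ) • 1 ∧
      diagOp v γ + (ε : ℂ) • 1 ≤ diagOp v (γ + (ε * d) • 1) := by
  have hpos : IsStrictlyPositive (diagOp v 1) := diagOp_isStrictlyPositive v fun _ => zero_lt_one
  obtain ⟨c, hc, hc1⟩ := exists_pos_smul_le hpos.isSelfAdjoint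
    (isUnit_one.isStrictlyPositive zero_le_one)
  obtain ⟨d, hd, h1d⟩ := exists_pos_smul_le (IsSelfAdjoint.one (H →L[ℂ] H)) hpos
  have hsplit (γ : ι → ℝ) (ε k : ℝ) :
      diagOp v (γ + (ε * k) • 1) = diagOp v γ + ε • k • diagOp v 1 := by
    rw [diagOp_add, diagOp_smul, Complex.coe_smul, smul_smul]
  refine ⟨c, d⁻¹, hc, inv_pos.2 hd, fun γ ε hε => ?_⟩
  rw [hsplit, hsplit, Complex.coe_smul]
  exact ⟨add_le_add_right (smul_le_smul_of_nonneg_left hc1 hε) _,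
    add_le_add_right (smul_le_smul_of_nonneg_left ((le_inv_smul_iff_of_pos hd).2 h1d) hε) _⟩

theorem isKuboAndoMean_diagOp {ι : Type*} [Fintype ι] (v : Module.Basis ι ℂ H) {α β : ι → ℝ}
    (hα : 0 ≤ α) (hβ : 0 ≤ β) {t : ℝ} (ht : t ∈ Icc 0 1) :
    IsKuboAndoMean t (diagOp v β) (diagOp v α) (diagOp v fun i => α i ^ t * β i ^ (1 - t)) := by
  obtain ⟨c, d, hc, hd, hbounds⟩ := exists_diagOp_add_le v
  have hpos {γ : ι → ℝ} (hγ : 0 ≤ γ) {ε k : ℝ} (hε : 0 < ε) (hk : 0 < k) (i : ι) :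
      0 < (γ + (ε * k) • 1) i := by
    simpa using add_pos_of_nonneg_of_pos (hγ i) (mul_pos hε hk)
  have hmean {ε k : ℝ} (hε : 0 < ε) (hk : 0 < k) := geomMean_diagOp v
    (fun i => (hpos hα hε hk i).le) (hpos hβ hε hk) ht.1
  have hlim {k : ℝ} (hk : 0 < k) :
      Tendsto (fun ε : ℝ => geomMean t (diagOp v (β + (ε * k) • 1)) (diagOp v (α + (ε * k) • 1)))
        (𝓝[>] 0) (𝓝 (diagOp v fun i => α i ^ t * β i ^ (1 - t))) := by
    have hentry (a : ℝ) : Tendsto (fun ε : ℝ => a + ε * k) (𝓝[>] 0) (𝓝 a) := by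
      have : Tendsto (fun ε : ℝ => a + ε * k) (𝓝 0) (𝓝 (a + 0 * k)) :=
        Continuous.tendsto (by fun_prop) 0
      simpa using this.mono_left nhdsWithin_le_nhds
    refine (tendsto_diagOp v (tendsto_pi_nhds.2 fun i => ?_)).congr'
      (eventually_mem_nhdsWithin.mono fun ε hε => (hmean hε hk).symm)
    simpa using ((hentry (α i)).rpow_const (.inr ht.1)).mul
      ((hentry (β i)).rpow_const (.inr (sub_nonneg.2 ht.2)))
  refine tendsto_of_tendsto_of_tendsto_of_le_of_le' (hlim hc) (hlim hd) ?_ ?_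
  · filter_upwards [self_mem_nhdsWithin] with ε (hε : 0 < ε)
    exact geomMean_mono (diagOp_isStrictlyPositive v (hpos hα hε hc))
      (diagOp_isStrictlyPositive v (hpos hβ hε hc)) (hbounds α hε.le).1 (hbounds β hε.le).1 ht
  · filter_upwards [self_mem_nhdsWithin] with ε (hε : 0 < ε)
    exact geomMean_mono
      ((diagOp_isStrictlyPositive v (hpos hα hε hc)).of_le (hbounds α hε.le).1)
      ((diagOp_isStrictlyPositive v (hpos hβ hε hc)).of_le (hbounds β hε.le).1)
      (hbounds α hε.le).2 (hbounds β hε.le).2 ht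

theorem IsKuboAndoMean.exists_eq_diagOp {t : ℝ} (ht : t ∈ Icc 0 1) {A B G : H →L[ℂ] H}
    (hA : 0 ≤ A) (hB : 0 ≤ B) (hG : IsKuboAndoMean t B A G) :
    ∃ (v : Module.Basis (Fin (Module.finrank ℂ H)) ℂ H) (α β : Fin (Module.finrank ℂ H) → ℝ),
      0 ≤ α ∧ 0 ≤ β ∧ A = diagOp v α ∧ B = diagOp v β ∧
        G = diagOp v fun i => α i ^ t * β i ^ (1 - t) := by
  obtain ⟨v, α, β, hα, hβ, rfl, rfl⟩ := exists_simultaneous_diagOp hA hB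
  exact ⟨v, α, β, hα, hβ, rfl, rfl, tendsto_nhds_unique hG (isKuboAndoMean_diagOp v hα hβ ht)⟩

end KuboAndoMean

section OpPower

variable {H : Type*} [NormedAddCommGroup H] [InnerProductSpace ℂ H] [FiniteDimensional ℂ H]
  {n : ℕ}

theorem opPower_diagOp {ι : Type*} [Fintype ι] (v : ι → H) (α : ι → ℝ) (n : ℕ) :
    opPower (diagOp v α) n = (diagOp (fun f : Fin n → ι => pureTensor (v ∘ f))
      (fun f => ∏ k, α (f k))).toLinearMap := by
  classical
  refine PiTensorProduct.ext (MultilinearMap.ext fun x => ?_)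
  change opPower (diagOp v α) n (pureTensor x) = diagOp _ _ (pureTensor x)
  rw [opPower_pureTensor, diagOp_apply]
  simp only [diagOp_apply, inner_pureTensor, smul_smul]
  refine (MultilinearMap.map_sum (PiTensorProduct.tprod ℂ) _).trans
    (Finset.sum_congr rfl fun f _ => ?_)
  refine (MultilinearMap.map_smul_univ (PiTensorProduct.tprod ℂ) _ _).trans ?_
  rw [Finset.prod_mul_distrib, Complex.ofReal_prod]
  rfl

theorem opPower_nonneg {A : H →L[ℂ] H} (hA : 0 ≤ A) (n : ℕ) : 0 ≤ opPower A n := by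
  have := FiniteDimensional.complete ℂ H
  obtain ⟨v, α, -, hα, -, rfl, -⟩ := exists_simultaneous_diagOp hA hA
  rw [opPower_diagOp, LinearMap.nonneg_iff_isPositive,
    ContinuousLinearMap.isPositive_toLinearMap_iff, ← ContinuousLinearMap.nonneg_iff_isPositive]
  exact diagOp_nonneg _ fun f => Finset.prod_nonneg fun k _ => hα (f k)

theorem opPower_mono {A B : H →L[ℂ] H} (hA : 0 ≤ A) (hAB : A ≤ B) (n : ℕ) :
    opPower A n ≤ opPower B n := by
  have := FiniteDimensional.complete ℂ H
  obtain ⟨v, α, β, hα, -, rfl, rfl⟩ := exists_simultaneous_diagOp hA (hA.trans hAB)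
  have hαβ : α ≤ β := by
    rwa [← sub_nonneg, ← diagOp_nonneg_iff v, diagOp_sub, sub_nonneg]
  rw [opPower_diagOp, opPower_diagOp, ContinuousLinearMap.coe_le_coe_iff]
  exact diagOp_mono _ fun f => Finset.prod_le_prod (fun k _ => hα _) fun k _ => hαβ _

/-- The quadratic form `z ↦ ⟨z, A^{⊗n} z⟩` of a tensor power. For positive semi-definite `A` it is
real, so that taking the real part only changes the type. -/
def powForm (A : H →L[ℂ] H) (z : HilbertPower H n) : ℝ :=
  (inner ℂ z (opPower A n z)).re

theorem inner_opPower_self {A : H →L[ℂ] H} (hA : 0 ≤ A) (z : HilbertPower H n) :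
    inner ℂ z (opPower A n z) = powForm A z :=
  (((LinearMap.nonneg_iff_isPositive _).1
    (opPower_nonneg hA n)).isSymmetric.coe_re_inner_self_apply z).symm

theorem powForm_nonneg {A : H →L[ℂ] H} (hA : 0 ≤ A) (z : HilbertPower H n) : 0 ≤ powForm A z :=
  ((LinearMap.nonneg_iff_isPositive _).1 (opPower_nonneg hA n)).re_inner_nonneg_right z

theorem powForm_mono {A B : H →L[ℂ] H} (hA : 0 ≤ A) (hAB : A ≤ B) (z : HilbertPower H n) :
    powForm A z ≤ powForm B z := by
  have := ((LinearMap.le_def _ _).1 (opPower_mono hA hAB n)).re_inner_nonneg_right z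
  simpa [powForm, inner_sub_right] using this

theorem powForm_diagOp {ι : Type*} [Fintype ι] (v : ι → H) (α : ι → ℝ) (z : HilbertPower H n) :
    powForm (diagOp v α) z =
      ∑ f : Fin n → ι, (∏ k, α (f k)) * ‖inner ℂ (pureTensor (v ∘ f)) z‖ ^ 2 := by
  rw [powForm, opPower_diagOp, ContinuousLinearMap.coe_coe, inner_diagOp_self, Complex.ofReal_re]

theorem powTr_rankOne (A : H →L[ℂ] H) (z : HilbertPower H n) :
    powTr A n (rankOne ℂ z z) = powForm A z := by
  have : opPower A n ∘ₗ (rankOne ℂ z z).toLinearMap =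
      (rankOne ℂ (opPower A n z) z).toLinearMap := by
    ext y; simp
  rw [powTr, this, trace_rankOne, powForm]

theorem exists_powTr_eq_sum_powForm {X : HilbertPower H n →ₗ[ℂ] HilbertPower H n}
    (hX : X.IsPositive) :
    ∃ (m : ℕ) (u : Fin m → HilbertPower H n), ∀ A : H →L[ℂ] H,
      powTr A n X = ∑ i, powForm A (u i) := by
  have hX' : X.toContinuousLinearMap.IsPositive :=
    (ContinuousLinearMap.isPositive_toLinearMap_iff _).1 hX
  obtain ⟨m, u, hu⟩ := ContinuousLinearMap.isPositive_iff_eq_sum_rankOne.1 hX'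
  have hXu : X = ∑ i, (rankOne ℂ (u i) (u i)).toLinearMap := by
    rw [← ContinuousLinearMap.toLinearMap_sum, ← hu]
    rfl
  refine ⟨m, u, fun A => ?_⟩
  rw [hXu, powTr, ← Module.End.mul_eq_comp, Finset.mul_sum, map_sum, Complex.re_sum]
  exact Finset.sum_congr rfl fun i _ => powTr_rankOne A (u i)

theorem powTr_nonneg {A : H →L[ℂ] H} (hA : 0 ≤ A) {X : HilbertPower H n →ₗ[ℂ] HilbertPower H n}
    (hX : X.IsPositive) : 0 ≤ powTr A n X := by
  obtain ⟨m, u, hu⟩ := exists_powTr_eq_sum_powForm hX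
  exact hu A ▸ Finset.sum_nonneg fun i _ => powForm_nonneg hA (u i)

end OpPower

section MeanInequalities

theorem mul_rpow_mul_mul_rpow {a b w : ℝ} (ha : 0 ≤ a) (hb : 0 ≤ b) (hw : 0 ≤ w) {t : ℝ}
    (ht : t ∈ Icc 0 1) : (a * w) ^ t * (b * w) ^ (1 - t) = a ^ t * b ^ (1 - t) * w := by
  rw [Real.mul_rpow ha hw, Real.mul_rpow hb hw, mul_mul_mul_comm,
    ← Real.rpow_add_of_nonneg hw ht.1 (sub_nonneg.2 ht.2), add_sub_cancel, Real.rpow_one]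

theorem prod_rpow_mul_rpow {ι κ : Type*} {α β : ι → ℝ} (hα : 0 ≤ α) (hβ : 0 ≤ β) (t : ℝ)
    (s : Finset κ) (f : κ → ι) :
    ∏ k ∈ s, α (f k) ^ t * β (f k) ^ (1 - t) =
      (∏ k ∈ s, α (f k)) ^ t * (∏ k ∈ s, β (f k)) ^ (1 - t) := by
  rw [Finset.prod_mul_distrib, Real.finsetProd_rpow _ _ (fun _ _ => hα _),
    Real.finsetProd_rpow _ _ (fun _ _ => hβ _)]

theorem sum_rpow_mul_rpow_mul_le {σ : Type*} (s : Finset σ) {a b w : σ → ℝ} (ha : 0 ≤ a)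
    (hb : 0 ≤ b) (hw : 0 ≤ w) {t : ℝ} (ht : t ∈ Icc 0 1) :
    ∑ i ∈ s, a i ^ t * b i ^ (1 - t) * w i ≤
      (∑ i ∈ s, a i * w i) ^ t * (∑ i ∈ s, b i * w i) ^ (1 - t) := by
  rcases ht.1.eq_or_lt with rfl | ht0
  · simp
  rcases ht.2.eq_or_lt with rfl | ht1
  · simp
  have hpq : (t⁻¹).HolderConjugate (1 - t)⁻¹ :=
    Real.holderConjugate_iff.2 ⟨(one_lt_inv₀ ht0).2 ht1, by simp⟩
  have hrpow {x s : ℝ} (hx : 0 ≤ x) (hs : 0 < s) : (x ^ s) ^ s⁻¹ = x :=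
    Real.rpow_rpow_inv hx hs.ne'
  have hHolder := Real.inner_le_Lp_mul_Lq_of_nonneg s hpq
    (f := fun i => (a i * w i) ^ t) (g := fun i => (b i * w i) ^ (1 - t))
    (fun i _ => Real.rpow_nonneg (mul_nonneg (ha i) (hw i)) _)
    (fun i _ => Real.rpow_nonneg (mul_nonneg (hb i) (hw i)) _)
  simpa only [mul_rpow_mul_mul_rpow (ha _) (hb _) (hw _) ht, one_div, inv_inv,
    hrpow (mul_nonneg (ha _) (hw _)) ht0,
    hrpow (mul_nonneg (hb _) (hw _)) (sub_pos.2 ht1)] using hHolder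

theorem rpow_mul_rpow_le_max {a b : ℝ} (ha : 0 ≤ a) (hb : 0 ≤ b) {t : ℝ} (ht : t ∈ Icc 0 1) :
    a ^ t * b ^ (1 - t) ≤ max a b := by
  have ht' := sub_nonneg.2 ht.2
  calc a ^ t * b ^ (1 - t) ≤ t * a + (1 - t) * b :=
        Real.geom_mean_le_arith_mean2_weighted ht.1 ht' ha hb (by ring)
    _ ≤ t * max a b + (1 - t) * max a b := by
        gcongr
        exacts [ht.1, le_max_left a b, le_max_right a b]
    _ = max a b := by ring

variable {H : Type*} [NormedAddCommGroup H] [InnerProductSpace ℂ H] [FiniteDimensional ℂ H]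
  [CompleteSpace H] {A B G : H →L[ℂ] H} {t : ℝ} {n : ℕ}

namespace IsKuboAndoMean

theorem powForm_le (ht : t ∈ Icc 0 1) (hA : 0 ≤ A) (hB : 0 ≤ B) (hG : IsKuboAndoMean t B A G)
    (z : HilbertPower H n) : powForm G z ≤ powForm A z ^ t * powForm B z ^ (1 - t) := by
  obtain ⟨v, α, β, hα, hβ, rfl, rfl, rfl⟩ := hG.exists_eq_diagOp ht hA hB
  simp only [powForm_diagOp, prod_rpow_mul_rpow hα hβ]
  exact sum_rpow_mul_rpow_mul_le _ (fun f => Finset.prod_nonneg fun k _ => hα (f k))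
    (fun f => Finset.prod_nonneg fun k _ => hβ (f k)) (fun f => sq_nonneg _) ht

theorem powTr_le_of_le {C : H →L[ℂ] H} (ht : t ∈ Icc 0 1) (hA : 0 ≤ A) (hB : 0 ≤ B)
    (hC : 0 ≤ C) (hG : IsKuboAndoMean t B A G) (hCG : C ≤ G)
    {X : HilbertPower H n →ₗ[ℂ] HilbertPower H n} (hX : X.IsPositive) :
    powTr C n X ≤ powTr A n X ^ t * powTr B n X ^ (1 - t) := by
  obtain ⟨m, u, hu⟩ := exists_powTr_eq_sum_powForm hX
  simp only [hu]
  calc ∑ i, powForm C (u i) ≤ ∑ i, powForm A (u i) ^ t * powForm B (u i) ^ (1 - t) * 1 := by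
        gcongr with i
        rw [mul_one]
        exact (powForm_mono hC hCG (u i)).trans (hG.powForm_le ht hA hB (u i))
    _ ≤ (∑ i, powForm A (u i)) ^ t * (∑ i, powForm B (u i)) ^ (1 - t) := by
        simpa only [Pi.one_apply, mul_one] using sum_rpow_mul_rpow_mul_le Finset.univ (w := 1)
          (fun i => powForm_nonneg hA (u i)) (fun i => powForm_nonneg hB (u i)) zero_le_one ht

theorem opPower_le (ht : t ∈ Icc 0 1) (hA : 0 ≤ A) (hB : 0 ≤ B) (hG : IsKuboAndoMean t B A G)
    (n : ℕ) : opPower G n ≤ (t : ℂ) • opPower A n + ((1 - t : ℝ) : ℂ) • opPower B n := by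
  obtain ⟨v, α, β, hα, hβ, rfl, rfl, rfl⟩ := hG.exists_eq_diagOp ht hA hB
  simp only [opPower_diagOp, ← ContinuousLinearMap.toLinearMap_smul,
    ← ContinuousLinearMap.toLinearMap_add, ← diagOp_smul, ← diagOp_add,
    ContinuousLinearMap.coe_le_coe_iff, prod_rpow_mul_rpow hα hβ]
  exact diagOp_mono _ fun f => Real.geom_mean_le_arith_mean2_weighted ht.1 (sub_nonneg.2 ht.2)
    (Finset.prod_nonneg fun k _ => hα (f k)) (Finset.prod_nonneg fun k _ => hβ (f k)) (by ring)

end IsKuboAndoMean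

end MeanInequalities

section TensorProductOfVectors

variable {H : Type*} [NormedAddCommGroup H] [InnerProductSpace ℂ H] {m n : ℕ}

/-- The tensor product `z ⊗ w`, seen in the tensor power of order `m + n`. -/
def powMul : HilbertPower H m →ₗ[ℂ] HilbertPower H n →ₗ[ℂ] HilbertPower H (m + n) :=
  (TensorProduct.mk ℂ (⨂[ℂ] _ : Fin m, H) (⨂[ℂ] _ : Fin n, H)).compr₂
    TensorPower.mulEquiv.toLinearMap

theorem powMul_pureTensor (x : Fin m → H) (y : Fin n → H) :
    powMul (pureTensor x) (pureTensor y) = pureTensor (Fin.append x y) :=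
  TensorPower.tprod_mul_tprod ℂ x y

@[elab_as_elim]
theorem HilbertPower.induction_on {p : HilbertPower H n → Prop} (z : HilbertPower H n)
    (smul_pureTensor : ∀ (c : ℂ) (x : Fin n → H), p (c • pureTensor x))
    (add : ∀ z w, p z → p w → p (z + w)) : p z :=
  PiTensorProduct.induction_on z smul_pureTensor add

theorem opPower_powMul (A : H →L[ℂ] H) (z : HilbertPower H m) (w : HilbertPower H n) :
    opPower A (m + n) (powMul z w) = powMul (opPower A m z) (opPower A n w) := by
  induction z using HilbertPower.induction_on with
  | add z z' hz hz' => simp only [map_add, LinearMap.add_apply, hz, hz']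
  | smul_pureTensor c x =>
    induction w using HilbertPower.induction_on with
    | add w w' hw hw' => simp only [map_add, hw, hw']
    | smul_pureTensor d y =>
      simp only [map_smul, LinearMap.smul_apply, powMul_pureTensor, opPower_pureTensor]
      congr 3
      ext i
      cases i using Fin.addCases <;> simp

variable [FiniteDimensional ℂ H]

theorem inner_powMul (z z' : HilbertPower H m) (w w' : HilbertPower H n) :
    inner ℂ (powMul z w) (powMul z' w') = inner ℂ z z' * inner ℂ w w' := by
  induction z using HilbertPower.induction_on with
  | add z₁ z₂ h₁ h₂ => simp only [map_add, LinearMap.add_apply, inner_add_left, add_mul, h₁, h₂]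
  | smul_pureTensor a x =>
  induction z' using HilbertPower.induction_on with
  | add z₁ z₂ h₁ h₂ => simp only [map_add, LinearMap.add_apply, inner_add_right, add_mul, h₁, h₂]
  | smul_pureTensor a' x' =>
  induction w using HilbertPower.induction_on with
  | add w₁ w₂ h₁ h₂ => simp only [map_add, inner_add_left, mul_add, h₁, h₂]
  | smul_pureTensor b y =>
  induction w' using HilbertPower.induction_on with
  | add w₁ w₂ h₁ h₂ => simp only [map_add, inner_add_right, mul_add, h₁, h₂]
  | smul_pureTensor b' y' =>
    simp only [map_smul, LinearMap.smul_apply, powMul_pureTensor, inner_smul_left,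
      inner_smul_right, inner_pureTensor, Fin.prod_univ_add, Fin.append_left, Fin.append_right]
    ring

theorem powForm_powMul {A : H →L[ℂ] H} (hA : 0 ≤ A) (z : HilbertPower H m)
    (w : HilbertPower H n) : powForm A (powMul z w) = powForm A z * powForm A w := by
  rw [powForm, opPower_powMul, inner_powMul, inner_opPower_self hA, inner_opPower_self hA,
    ← Complex.ofReal_mul, Complex.ofReal_re]

theorem powForm_pureTensor_const {A : H →L[ℂ] H} (hA : 0 ≤ A) (n : ℕ) (x : H) :
    powForm A (pureTensor fun _ : Fin n => x) = (inner ℂ x (A x)).re ^ n := by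
  have hre : inner ℂ x (A x) = ((inner ℂ x (A x)).re : ℂ) :=
    (((ContinuousLinearMap.nonneg_iff_isPositive _).1 hA).isSymmetric.coe_re_inner_self_apply
      x).symm
  rw [powForm, opPower_pureTensor, inner_pureTensor, Finset.prod_const, Finset.card_univ,
    Fintype.card_fin, hre, ← Complex.ofReal_pow, Complex.ofReal_re, Complex.ofReal_re]

theorem exists_powForm_eq_pow (z : HilbertPower H n) (k : ℕ) :
    ∃ w : HilbertPower H (n * k), ∀ A : H →L[ℂ] H, 0 ≤ A → powForm A w = powForm A z ^ k := by
  induction k with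
  | zero =>
    exact ⟨pureTensor fun _ : Fin 0 => 0, fun A hA => by
      simpa using powForm_pureTensor_const hA 0 (0 : H)⟩
  | succ k ih =>
    obtain ⟨w, hw⟩ := ih
    exact ⟨powMul w z, fun A hA => by rw [pow_succ, ← hw A hA]; exact powForm_powMul hA w z⟩

theorem powForm_sum_le {A : H →L[ℂ] H} (hA : 0 ≤ A) {σ : Type*} (s : Finset σ)
    (z : σ → HilbertPower H n) :
    powForm A (∑ i ∈ s, z i) ≤ s.card * ∑ i ∈ s, powForm A (z i) := by
  have := FiniteDimensional.complete ℂ H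
  obtain ⟨v, α, -, hα, -, rfl, -⟩ := exists_simultaneous_diagOp hA hA
  simp only [powForm_diagOp, inner_sum]
  rw [Finset.sum_comm, Finset.mul_sum]
  refine Finset.sum_le_sum fun f _ => ?_
  rw [← Finset.mul_sum, mul_left_comm]
  refine mul_le_mul_of_nonneg_left ?_ (Finset.prod_nonneg fun k _ => hα _)
  calc ‖∑ i ∈ s, inner ℂ (pureTensor (v ∘ f)) (z i)‖ ^ 2
      ≤ (∑ i ∈ s, ‖inner ℂ (pureTensor (v ∘ f)) (z i)‖) ^ 2 := by
        gcongr
        exact norm_sum_le _ _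
    _ ≤ s.card * ∑ i ∈ s, ‖inner ℂ (pureTensor (v ∘ f)) (z i)‖ ^ 2 := sq_sum_le_card_mul_sum_sq

end TensorProductOfVectors

section Subexponential

/-- The sequence `r` grows at most subexponentially: `limsup (1 / n) log (r n) ≤ 0`, stated without
logarithms so that no positivity is required. -/
def IsSubexponential (r : ℕ → ℝ) : Prop :=
  ∀ ε > 0, ∀ᶠ n : ℕ in atTop, r n ≤ Real.exp (ε * n)

theorem isSubexponential_natCast_add_one_pow (d : ℕ) :
    IsSubexponential fun n => ((n : ℝ) + 1) ^ d := by
  intro ε hε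
  have hshift : Tendsto (fun n : ℕ => (n : ℝ) + 1) atTop atTop :=
    tendsto_atTop_add_const_right _ 1 tendsto_natCast_atTop_atTop
  filter_upwards [((isLittleO_pow_exp_pos_mul_atTop d hε).comp_tendsto hshift).bound
    (Real.exp_pos (-ε))] with n hn
  calc ((n : ℝ) + 1) ^ d ≤ Real.exp (-ε) * Real.exp (ε * (n + 1)) := by
        simpa [abs_of_pos (Nat.cast_add_one_pos (α := ℝ) n)] using hn
    _ = Real.exp (ε * n) := by rw [← Real.exp_add]; ring_nf

theorem isSubexponential_const (c : ℝ) : IsSubexponential fun _ => c := fun _ hε =>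
  (Real.tendsto_exp_atTop.comp
    (tendsto_natCast_atTop_atTop.const_mul_atTop hε)).eventually_ge_atTop c

theorem isSubexponential_of_tendsto_log {r : ℕ → ℝ}
    (h : Tendsto (fun n : ℕ => ((1 / (n : ℝ) : ℝ) : EReal) * ENNReal.log (ENNReal.ofReal (r n)))
      atTop (𝓝 0)) : IsSubexponential r := by
  intro ε hε
  filter_upwards [h.eventually (gt_mem_nhds (EReal.coe_pos.2 hε)), eventually_gt_atTop 0]
    with n hlog hn
  rcases le_or_gt (r n) 0 with hr | hr
  · exact hr.trans (Real.exp_nonneg _)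
  · rw [ENNReal.log_ofReal_of_pos hr, ← EReal.coe_mul, EReal.coe_lt_coe_iff, one_div,
      inv_mul_lt_iff₀ (Nat.cast_pos.2 hn), mul_comm] at hlog
    exact (Real.log_le_iff_le_exp hr).1 hlog.le

theorem IsSubexponential.comp_mul_left {r : ℕ → ℝ} (hr : IsSubexponential r) {n : ℕ} (hn : 0 < n) :
    IsSubexponential fun k => r (n * k) := by
  intro ε hε
  have hn' : (0 : ℝ) < n := Nat.cast_pos.2 hn
  filter_upwards [(tendsto_id.const_mul_atTop' hn).eventually (hr (ε / n) (div_pos hε hn'))]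
    with k hk
  refine hk.trans_eq (congrArg Real.exp ?_)
  simp only [id, Nat.cast_mul]
  field_simp

theorem IsSubexponential.le_of_pow_le {r : ℕ → ℝ} (hr : IsSubexponential r) {a b : ℝ} (hb : 0 ≤ b)
    (h : ∀ᶠ n in atTop, a ^ n ≤ r n * b ^ n) : a ≤ b := by
  have hexp : ∀ ε > 0, a ≤ Real.exp ε * b := by
    intro ε hε
    obtain ⟨n, hn, hrn, hn0⟩ := (h.and ((hr ε hε).and (eventually_ne_atTop 0))).exists
    refine le_of_pow_le_pow_left₀ hn0 (mul_nonneg (Real.exp_nonneg ε) hb) ?_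
    calc a ^ n ≤ r n * b ^ n := hn
      _ ≤ Real.exp (ε * n) * b ^ n := by gcongr
      _ = (Real.exp ε * b) ^ n := by rw [mul_comm ε, Real.exp_nat_mul, mul_pow]
  have hlim : Tendsto (fun ε : ℝ => Real.exp ε * b) (𝓝[>] 0) (𝓝 b) := by
    have : Tendsto (fun ε : ℝ => Real.exp ε * b) (𝓝 0) (𝓝 (Real.exp 0 * b)) :=
      Continuous.tendsto (by fun_prop) 0
    simpa using this.mono_left nhdsWithin_le_nhds
  exact ge_of_tendsto hlim (eventually_mem_nhdsWithin.mono hexp)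

end Subexponential

section Separation

/-- Natural combinations `m p + n q` with first coordinate just below `0` approximate, after
division by `n`, the real one whose first coordinate is exactly `0`. -/
theorem div_le_div_of_fst_pos_of_fst_neg {K : AddSubmonoid (ℝ × ℝ)}
    (hK : ∀ p ∈ K, p.2 ≤ max 0 p.1) {p q : ℝ × ℝ} (hp : p ∈ K) (hq : q ∈ K) (hp0 : 0 < p.1)
    (hq0 : q.1 < 0) : p.2 / p.1 ≤ q.2 / q.1 := by
  have hs : 0 ≤ -q.1 / p.1 := div_nonneg (neg_nonneg.2 hq0.le) hp0.le
  have hnat (n : ℕ) : (⌊-q.1 / p.1 * n⌋₊ : ℝ) * p.2 + n * q.2 ≤ 0 := by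
    have hfloor : (⌊-q.1 / p.1 * n⌋₊ : ℝ) * p.1 ≤ -(n * q.1) := by
      calc (⌊-q.1 / p.1 * n⌋₊ : ℝ) * p.1 ≤ -q.1 / p.1 * n * p.1 := by
            gcongr
            exact Nat.floor_le (mul_nonneg hs n.cast_nonneg)
        _ = -(n * q.1) := by field_simp
    have hmem := hK _ (K.add_mem (K.nsmul_mem hp ⌊-q.1 / p.1 * n⌋₊) (K.nsmul_mem hq n))
    simp only [Prod.snd_add, Prod.fst_add, Prod.smul_fst, Prod.smul_snd] at hmem
    simp only [nsmul_eq_mul] at hmem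
    rwa [max_eq_left (by linarith)] at hmem
  have hlim : Tendsto (fun n : ℕ => (⌊-q.1 / p.1 * n⌋₊ : ℝ) / n * p.2 + q.2) atTop
      (𝓝 (-q.1 / p.1 * p.2 + q.2)) :=
    (((tendsto_nat_floor_mul_div_atTop hs).comp
      tendsto_natCast_atTop_atTop).mul_const _).add_const _
  have hle : -q.1 / p.1 * p.2 + q.2 ≤ 0 := by
    refine le_of_tendsto hlim ((eventually_gt_atTop 0).mono fun n hn => ?_)
    have hn' : (0 : ℝ) < n := Nat.cast_pos.2 hn
    calc (⌊-q.1 / p.1 * n⌋₊ : ℝ) / n * p.2 + q.2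
        = ((⌊-q.1 / p.1 * n⌋₊ : ℝ) * p.2 + n * q.2) / n := by field_simp
      _ ≤ 0 := div_nonpos_of_nonpos_of_nonneg (hnat n) hn'.le
  rw [le_div_iff_of_neg hq0]
  calc q.2 ≤ q.1 / p.1 * p.2 := by rw [neg_div] at hle; linarith
    _ = p.2 / p.1 * q.1 := by ring

theorem exists_forall_snd_le_mul_fst {K : AddSubmonoid (ℝ × ℝ)} (hK : ∀ p ∈ K, p.2 ≤ max 0 p.1) :
    ∃ t ∈ Icc (0 : ℝ) 1, ∀ p ∈ K, p.2 ≤ t * p.1 := by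
  let lower : Set ℝ := insert 0 {s | ∃ p ∈ K, 0 < p.1 ∧ p.2 / p.1 = s}
  let upper : Set ℝ := insert 1 {s | ∃ p ∈ K, p.1 < 0 ∧ p.2 / p.1 = s}
  have hle : ∀ s ∈ lower, ∀ s' ∈ upper, s ≤ s' := by
    rintro _ (rfl | ⟨p, hp, hp0, rfl⟩) _ (rfl | ⟨q, hq, hq0, rfl⟩)
    · exact zero_le_one
    · exact div_nonneg_of_nonpos ((hK q hq).trans_eq (max_eq_left hq0.le)) hq0.le
    · exact (div_le_one hp0).2 ((hK p hp).trans_eq (max_eq_right hp0.le))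
    · exact div_le_div_of_fst_pos_of_fst_neg hK hp hq hp0 hq0
  obtain ⟨t, hlower, hupper⟩ :=
    exists_between_of_forall_le (insert_nonempty _ _) (insert_nonempty _ _) hle
  refine ⟨t, ⟨hlower (mem_insert _ _), hupper (mem_insert _ _)⟩, fun p hp => ?_⟩
  rcases lt_trichotomy p.1 0 with hp0 | hp0 | hp0
  · exact (le_div_iff_of_neg hp0).1 (hupper (mem_insert_of_mem _ ⟨p, hp, hp0, rfl⟩))
  · simpa [hp0] using hK p hp
  · exact (div_le_iff₀ hp0).1 (hlower (mem_insert_of_mem _ ⟨p, hp, hp0, rfl⟩))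

theorem le_of_forall_mul_pow_le {a b c d : ℝ} (ha : 0 < a) (hd : 0 ≤ d)
    (h : ∀ n : ℕ, a * c ^ n ≤ b * d ^ n) : c ≤ d := by
  refine (isSubexponential_const (b / a)).le_of_pow_le hd (.of_forall fun n => ?_)
  rw [div_mul_eq_mul_div, le_div_iff₀ ha, mul_comm]
  exact h n

theorem exists_forall_le_rpow_mul_rpow_of_pos {K : Submonoid (ℝ × ℝ × ℝ)}
    (hmax : ∀ p ∈ K, p.2.2 ≤ max p.1 p.2.1) (hpos : ∀ p ∈ K, 0 < p.2.2 → 0 < p.1 ∧ 0 < p.2.1) :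
    ∃ t ∈ Icc (0 : ℝ) 1, ∀ p ∈ K, 0 < p.2.2 → p.2.2 ≤ p.1 ^ t * p.2.1 ^ (1 - t) := by
  let L : AddSubmonoid (ℝ × ℝ) :=
    { carrier := {q | ∃ p ∈ K, 0 < p.2.2 ∧
        q = (Real.log p.1 - Real.log p.2.1, Real.log p.2.2 - Real.log p.2.1)}
      zero_mem' := ⟨1, K.one_mem, zero_lt_one, by simp [Prod.ext_iff]⟩
      add_mem' := by
        rintro _ _ ⟨p, hp, hp0, rfl⟩ ⟨q, hq, hq0, rfl⟩
        obtain ⟨hp1, hp2⟩ := hpos p hp hp0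
        obtain ⟨hq1, hq2⟩ := hpos q hq hq0
        refine ⟨p * q, K.mul_mem hp hq, mul_pos hp0 hq0, ?_⟩
        simp only [Prod.fst_mul, Prod.snd_mul, Real.log_mul hp0.ne' hq0.ne',
          Real.log_mul hp1.ne' hq1.ne', Real.log_mul hp2.ne' hq2.ne', Prod.mk_add_mk]
        congr 1 <;> ring }
  have hL : ∀ q ∈ L, q.2 ≤ max 0 q.1 := by
    rintro _ ⟨p, hp, hp0, rfl⟩
    rcases le_max_iff.1 (hmax p hp) with h | h
    · exact le_max_of_le_right (sub_le_sub_right (Real.log_le_log hp0 h) _)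
    · exact le_max_of_le_left (sub_nonpos.2 (Real.log_le_log hp0 h))
  obtain ⟨t, ht, htL⟩ := exists_forall_snd_le_mul_fst hL
  refine ⟨t, ht, fun p hp hp0 => ?_⟩
  obtain ⟨hp1, hp2⟩ := hpos p hp hp0
  have hlog := htL _ ⟨p, hp, hp0, rfl⟩
  have hpow1 := Real.rpow_pos_of_pos hp1 t
  have hpow2 := Real.rpow_pos_of_pos hp2 (1 - t)
  rw [← Real.log_le_log_iff hp0 (mul_pos hpow1 hpow2), Real.log_mul hpow1.ne' hpow2.ne',
    Real.log_rpow hp1, Real.log_rpow hp2]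
  linarith

theorem exists_forall_le_rpow_mul_rpow {K : Submonoid (ℝ × ℝ × ℝ)}
    (hnonneg : ∀ p ∈ K, 0 ≤ p.1 ∧ 0 ≤ p.2.1) (hmax : ∀ p ∈ K, p.2.2 ≤ max p.1 p.2.1) :
    ∃ t ∈ Icc (0 : ℝ) 1, ∀ p ∈ K, p.2.2 ≤ p.1 ^ t * p.2.1 ^ (1 - t) := by
  have hpow {p q : ℝ × ℝ × ℝ} (hp : p ∈ K) (hq : q ∈ K) (n : ℕ) :
      p.2.2 * q.2.2 ^ n ≤ max (p.1 * q.1 ^ n) (p.2.1 * q.2.1 ^ n) :=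
    hmax _ (K.mul_mem hp (K.pow_mem hq n))
  by_cases! hfst : ∃ p ∈ K, p.1 = 0 ∧ 0 < p.2.2
  · obtain ⟨p, hp, hp1, hp0⟩ := hfst
    refine ⟨0, ⟨le_rfl, zero_le_one⟩, fun q hq => ?_⟩
    have hle : q.2.2 ≤ q.2.1 := le_of_forall_mul_pow_le (b := p.2.1) hp0 (hnonneg q hq).2 fun n =>
      (hpow hp hq n).trans_eq (max_eq_right (by
        rw [hp1, zero_mul]
        exact mul_nonneg (hnonneg p hp).2 (pow_nonneg (hnonneg q hq).2 n)))
    simpa using hle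
  by_cases! hsnd : ∃ p ∈ K, p.2.1 = 0 ∧ 0 < p.2.2
  · obtain ⟨p, hp, hp2, hp0⟩ := hsnd
    refine ⟨1, ⟨zero_le_one, le_rfl⟩, fun q hq => ?_⟩
    have hle : q.2.2 ≤ q.1 := le_of_forall_mul_pow_le (b := p.1) hp0 (hnonneg q hq).1 fun n =>
      (hpow hp hq n).trans_eq (max_eq_left (by
        rw [hp2, zero_mul]
        exact mul_nonneg (hnonneg p hp).1 (pow_nonneg (hnonneg q hq).1 n)))
    simpa using hle
  obtain ⟨t, ht, h⟩ := exists_forall_le_rpow_mul_rpow_of_pos hmax fun p hp hp0 =>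
    ⟨(hnonneg p hp).1.lt_of_ne' fun h => (hfst p hp h).not_gt hp0,
      (hnonneg p hp).2.lt_of_ne' fun h => (hsnd p hp h).not_gt hp0⟩
  refine ⟨t, ht, fun p hp => ?_⟩
  rcases le_or_gt p.2.2 0 with hp0 | hp0
  · exact hp0.trans (mul_nonneg (Real.rpow_nonneg (hnonneg p hp).1 _)
      (Real.rpow_nonneg (hnonneg p hp).2 _))
  · exact h p hp hp0

end Separation

section Types

variable {ι : Type*} [Fintype ι] [DecidableEq ι] {n : ℕ}

/-- The type (in the sense of information theory) of the word `f`: how often each letter occurs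
in it. -/
def wordType (f : Fin n → ι) (i : ι) : Fin (n + 1) :=
  ⟨Finset.card {k | f k = i}, Nat.lt_succ_of_le ((Finset.card_le_univ _).trans_eq (by simp))⟩

theorem prod_comp_eq_prod_pow_wordType {M : Type*} [CommMonoid M] (α : ι → M) (f : Fin n → ι) :
    ∏ k, α (f k) = ∏ i, α i ^ (wordType f i : ℕ) := by
  rw [← Finset.prod_fiberwise' Finset.univ f α]
  simp only [Finset.prod_const]
  rfl

variable {H : Type*} [NormedAddCommGroup H] [InnerProductSpace ℂ H]

/-- The component of type `τ` of the tensor power `(∑ i, y i)^{⊗n}`: the sum of the elementary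
tensors `y (f 0) ⊗ ⋯ ⊗ y (f (n - 1))` over the words `f` of type `τ`. -/
def typePart (y : ι → H) (τ : ι → Fin (n + 1)) : HilbertPower H n :=
  ∑ f with wordType f = τ, pureTensor (y ∘ f)

theorem sum_typePart (y : ι → H) (n : ℕ) :
    ∑ τ, typePart y τ = pureTensor fun _ : Fin n => ∑ i, y i := by
  refine (Finset.sum_fiberwise Finset.univ wordType _).trans ?_
  exact (MultilinearMap.map_sum (PiTensorProduct.tprod ℂ) fun _ : Fin n => y).symm

variable [FiniteDimensional ℂ H] {v y : ι → H}

theorem inner_pureTensor_typePart_of_ne (h : ∀ i j, i ≠ j → inner ℂ (v i) (y j) = 0)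
    {f : Fin n → ι} {τ : ι → Fin (n + 1)} (hf : wordType f ≠ τ) :
    inner ℂ (pureTensor (v ∘ f)) (typePart y τ) = 0 := by
  rw [typePart, inner_sum]
  refine Finset.sum_eq_zero fun g hg => ?_
  obtain ⟨k, hk⟩ : ∃ k, f k ≠ g k := by
    by_contra! hfg
    exact hf (funext hfg ▸ (Finset.mem_filter.1 hg).2)
  rw [inner_pureTensor]
  exact Finset.prod_eq_zero (Finset.mem_univ k) (h _ _ hk)

theorem powForm_diagOp_typePart (h : ∀ i j, i ≠ j → inner ℂ (v i) (y j) = 0) (α : ι → ℝ)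
    (τ : ι → Fin (n + 1)) :
    powForm (diagOp v α) (typePart y τ) = (∏ i, α i ^ (τ i : ℕ)) *
      ∑ f : Fin n → ι, ‖inner ℂ (pureTensor (v ∘ f)) (typePart y τ)‖ ^ 2 := by
  rw [powForm_diagOp, Finset.mul_sum]
  refine Finset.sum_congr rfl fun f _ => ?_
  by_cases hf : wordType f = τ
  · rw [prod_comp_eq_prod_pow_wordType, hf]
  · simp [inner_pureTensor_typePart_of_ne h hf]

theorem sum_powForm_diagOp_typePart (h : ∀ i j, i ≠ j → inner ℂ (v i) (y j) = 0) (α : ι → ℝ)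
    (n : ℕ) : ∑ τ : ι → Fin (n + 1), powForm (diagOp v α) (typePart y τ) =
      powForm (diagOp v α) (pureTensor fun _ : Fin n => ∑ i, y i) := by
  simp only [powForm_diagOp, ← sum_typePart, inner_sum]
  rw [Finset.sum_comm]
  refine Finset.sum_congr rfl fun f _ => ?_
  rw [← Finset.mul_sum, Fintype.sum_eq_single (wordType f), Fintype.sum_eq_single (wordType f)]
  · exact fun τ hτ => inner_pureTensor_typePart_of_ne h hτ.symm
  · intro τ hτ
    simp [inner_pureTensor_typePart_of_ne h hτ.symm]

theorem powForm_diagOp_rpow_typePart (h : ∀ i j, i ≠ j → inner ℂ (v i) (y j) = 0) {α β : ι → ℝ}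
    (hα : 0 ≤ α) (hβ : 0 ≤ β) {t : ℝ} (ht : t ∈ Icc 0 1) (τ : ι → Fin (n + 1)) :
    powForm (diagOp v fun i => α i ^ t * β i ^ (1 - t)) (typePart y τ) =
      powForm (diagOp v α) (typePart y τ) ^ t * powForm (diagOp v β) (typePart y τ) ^ (1 - t) := by
  have hpow {γ : ι → ℝ} (hγ : 0 ≤ γ) : 0 ≤ fun i => γ i ^ (τ i : ℕ) :=
    fun i => pow_nonneg (hγ i) _
  simp only [powForm_diagOp_typePart h, mul_pow, Real.rpow_pow_comm (hα _),
    Real.rpow_pow_comm (hβ _)]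
  have hprod := prod_rpow_mul_rpow (hpow hα) (hpow hβ) t Finset.univ id
  simp only [id_eq] at hprod
  rw [hprod, mul_rpow_mul_mul_rpow
    (Finset.prod_nonneg fun i _ => hpow hα i) (Finset.prod_nonneg fun i _ => hpow hβ i)
    (Finset.sum_nonneg fun f _ => sq_nonneg _) ht]

end Types

section Converse

variable {H : Type*} [NormedAddCommGroup H] [InnerProductSpace ℂ H]

theorem opPower_zero_eq (A B : H →L[ℂ] H) : opPower A 0 = opPower B 0 :=
  congrArg PiTensorProduct.map (Subsingleton.elim _ _)

theorem le_of_forall_re_inner_le {A B : H →L[ℂ] H} (hA : A.IsSymmetric) (hB : B.IsSymmetric)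
    (h : ∀ x, (inner ℂ x (A x)).re ≤ (inner ℂ x (B x)).re) : A ≤ B := by
  refine (ContinuousLinearMap.le_def _ _).2 ⟨hB.sub hA, fun x => ?_⟩
  have hAx : inner ℂ (A x) x = inner ℂ x (A x) := hA x x
  have hBx : inner ℂ (B x) x = inner ℂ x (B x) := hB x x
  simpa [ContinuousLinearMap.reApplyInnerSelf, inner_sub_left, hAx, hBx] using h x

variable [FiniteDimensional ℂ H] {A₁ A₂ C : H →L[ℂ] H}

theorem powForm_le_add_mul_max {n : ℕ} {p q : ℝ} (hp : 0 ≤ p) (hq : 0 ≤ q)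
    (h : opPower C n ≤ (p : ℂ) • opPower A₁ n + (q : ℂ) • opPower A₂ n) (z : HilbertPower H n) :
    powForm C z ≤ (p + q) * max (powForm A₁ z) (powForm A₂ z) := by
  have hle : powForm C z ≤ p * powForm A₁ z + q * powForm A₂ z := by
    have := ((LinearMap.le_def _ _).1 h).re_inner_nonneg_right z
    simpa [powForm, inner_sub_right, inner_add_right, inner_smul_right,
      -Complex.coe_smul] using this
  refine hle.trans ?_
  rw [add_mul]
  gcongr
  exacts [le_max_left _ _, le_max_right _ _]

theorem powForm_le_max (hA₁ : 0 ≤ A₁) (hA₂ : 0 ≤ A₂) (hC : 0 ≤ C) {r : ℕ → ℝ}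
    (hr : IsSubexponential r)
    (h : ∀ n ≥ 1, ∀ z : HilbertPower H n, powForm C z ≤ r n * max (powForm A₁ z) (powForm A₂ z))
    {n : ℕ} (z : HilbertPower H n) : powForm C z ≤ max (powForm A₁ z) (powForm A₂ z) := by
  have h₁ := powForm_nonneg hA₁ z
  have h₂ := powForm_nonneg hA₂ z
  rcases n.eq_zero_or_pos with rfl | hn
  · rw [powForm, opPower_zero_eq C A₁]
    exact le_max_left _ _
  refine (hr.comp_mul_left hn).le_of_pow_le (le_max_of_le_left h₁)
    ((eventually_gt_atTop 0).mono fun k hk => ?_)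
  obtain ⟨w, hw⟩ := exists_powForm_eq_pow z k
  rw [pow_left_monotoneOn.map_max h₁ h₂, ← hw A₁ hA₁, ← hw A₂ hA₂, ← hw C hC]
  exact h (n * k) (Nat.mul_pos hn hk) w

theorem exists_powForm_le_rpow_mul_rpow (hA₁ : 0 ≤ A₁) (hA₂ : 0 ≤ A₂) (hC : 0 ≤ C)
    (h : ∀ (n : ℕ) (z : HilbertPower H n), powForm C z ≤ max (powForm A₁ z) (powForm A₂ z)) :
    ∃ t ∈ Icc (0 : ℝ) 1, ∀ (n : ℕ) (z : HilbertPower H n),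
      powForm C z ≤ powForm A₁ z ^ t * powForm A₂ z ^ (1 - t) := by
  let K : Submonoid (ℝ × ℝ × ℝ) :=
    { carrier := {p | ∃ (n : ℕ) (z : HilbertPower H n),
        p = (powForm A₁ z, powForm A₂ z, powForm C z)}
      one_mem' := ⟨0, pureTensor fun _ => 0, by
        simp [powForm_pureTensor_const, hA₁, hA₂, hC, Prod.ext_iff]⟩
      mul_mem' := by
        rintro _ _ ⟨m, z, rfl⟩ ⟨n, w, rfl⟩
        refine ⟨m + n, powMul z w, ?_⟩
        simp only [powForm_powMul hA₁, powForm_powMul hA₂, powForm_powMul hC, Prod.mk_mul_mk] }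
  obtain ⟨t, ht, hK⟩ := exists_forall_le_rpow_mul_rpow (K := K)
    (by rintro _ ⟨n, z, rfl⟩; exact ⟨powForm_nonneg hA₁ z, powForm_nonneg hA₂ z⟩)
    (by rintro _ ⟨n, z, rfl⟩; exact h n z)
  exact ⟨t, ht, fun n z => hK _ ⟨n, z, rfl⟩⟩

theorem le_diagOp_of_powForm_le {ι : Type*} [Fintype ι] (v : Module.Basis ι ℂ H) {α β : ι → ℝ}
    (hα : 0 ≤ α) (hβ : 0 ≤ β) {t : ℝ} (ht : t ∈ Icc 0 1) (hC : 0 ≤ C)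
    (h : ∀ (n : ℕ) (z : HilbertPower H n),
      powForm C z ≤ powForm (diagOp v α) z ^ t * powForm (diagOp v β) z ^ (1 - t)) :
    C ≤ diagOp v fun i => α i ^ t * β i ^ (1 - t) := by
  classical
  set G := diagOp v fun i => α i ^ t * β i ^ (1 - t) with hGdef
  have hG : 0 ≤ G := diagOp_nonneg v fun i =>
    mul_nonneg (Real.rpow_nonneg (hα i) _) (Real.rpow_nonneg (hβ i) _)
  have hC' := (ContinuousLinearMap.nonneg_iff_isPositive _).1 hC
  have hG' := (ContinuousLinearMap.nonneg_iff_isPositive _).1 hG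
  obtain ⟨w, hw⟩ := exists_inner_eq_ite v
  refine le_of_forall_re_inner_le hC'.isSymmetric hG'.isSymmetric fun x => ?_
  let y (i : ι) : H := inner ℂ (v i) x • w i
  have hy : ∑ i, y i = x := sum_inner_smul_eq v hw x
  have hvy (i j : ι) (hij : i ≠ j) : inner ℂ (v i) (y j) = 0 := by
    simp [y, hw, hij]
  refine (isSubexponential_natCast_add_one_pow (Fintype.card ι)).le_of_pow_le
    (hG'.re_inner_nonneg_right x) (.of_forall fun n => ?_)
  calc (inner ℂ x (C x)).re ^ n = powForm C (∑ τ : ι → Fin (n + 1), typePart y τ) := by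
        rw [sum_typePart, hy, powForm_pureTensor_const hC]
    _ ≤ ((n : ℝ) + 1) ^ Fintype.card ι *
          ∑ τ : ι → Fin (n + 1), powForm C (typePart y τ) := by
        simpa using powForm_sum_le hC Finset.univ (typePart (n := n) y)
    _ ≤ ((n : ℝ) + 1) ^ Fintype.card ι *
          ∑ τ : ι → Fin (n + 1), powForm G (typePart y τ) := by
        gcongr with τ
        rw [hGdef, powForm_diagOp_rpow_typePart hvy hα hβ ht]
        exact h n _
    _ = ((n : ℝ) + 1) ^ Fintype.card ι * (inner ℂ x (G x)).re ^ n := by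
        rw [sum_powForm_diagOp_typePart hvy, hy, powForm_pureTensor_const hG]

theorem exists_isKuboAndoMean_of_powForm_le [CompleteSpace H] (hA₁ : 0 ≤ A₁) (hA₂ : 0 ≤ A₂)
    (hC : 0 ≤ C) {r : ℕ → ℝ} (hr : IsSubexponential r)
    (h : ∀ n ≥ 1, ∀ z : HilbertPower H n,
      powForm C z ≤ r n * max (powForm A₁ z) (powForm A₂ z)) :
    ∃ t ∈ Icc (0 : ℝ) 1, ∃ G, IsKuboAndoMean t A₂ A₁ G ∧ C ≤ G := by
  obtain ⟨t, ht, hpow⟩ := exists_powForm_le_rpow_mul_rpow hA₁ hA₂ hC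
    fun n z => powForm_le_max hA₁ hA₂ hC hr h z
  obtain ⟨v, α, β, hα, hβ, rfl, rfl⟩ := exists_simultaneous_diagOp hA₁ hA₂
  exact ⟨t, ht, _, isKuboAndoMean_diagOp v hα hβ ht, le_diagOp_of_powForm_le v hα hβ ht hC hpow⟩

end Converse

end KuboAndoPowers

end

theorem mainTheorem5 {H : Type*} [NormedAddCommGroup H] [InnerProductSpace ℂ H]
    [FiniteDimensional ℂ H] [CompleteSpace H] (A₁ A₂ C : H →L[ℂ] H)
    (hA₁ : A₁.IsPositive) (hA₂ : A₂.IsPositive) (hC : C.IsPositive) :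
    List.TFAE [
      ∀ n : ℕ, 1 ≤ n → ∀ X : HilbertPower H n →ₗ[ℂ] HilbertPower H n,
        X.IsPositive →
          powTr C n X ≤
            max (powTr A₁ n X) (powTr A₂ n X),
      ∃ p ∈ Set.Icc (0 : ℝ) 1, ∀ n : ℕ, 1 ≤ n →
        opPower C n ≤
          (p : ℂ) • opPower A₁ n + ((1 - p : ℝ) : ℂ) • opPower A₂ n,
      ∃ p q : ℕ → ℝ,
        (∀ n : ℕ, 1 ≤ n → 0 ≤ p n ∧ 0 ≤ q n ∧
          opPower C n ≤
            (p n : ℂ) • opPower A₁ n + (q n : ℂ) • opPower A₂ n) ∧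
        Tendsto (fun n : ℕ => ((1 / (n : ℝ) : ℝ) : EReal) *
          ENNReal.log (ENNReal.ofReal (p n + q n))) atTop (𝓝 0),
      ∃ t ∈ Set.Icc (0 : ℝ) 1, ∀ n : ℕ, 1 ≤ n →
        ∀ X : HilbertPower H n →ₗ[ℂ] HilbertPower H n,
          X.IsPositive →
            powTr C n X ≤
              powTr A₁ n X ^ t * powTr A₂ n X ^ (1 - t),
      ∃ t ∈ Set.Icc (0 : ℝ) 1, ∃ G : H →L[ℂ] H,
        IsKuboAndoMean t A₂ A₁ G ∧ C ≤ G] := by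
  rw [← ContinuousLinearMap.nonneg_iff_isPositive] at hA₁ hA₂ hC
  tfae_have 1 → 5 := fun h =>
    exists_isKuboAndoMean_of_powForm_le hA₁ hA₂ hC (isSubexponential_const 1) fun n hn z => by
      simpa only [powTr_rankOne, one_mul] using h n hn _
        (InnerProductSpace.isPositive_rankOne_self z).toLinearMap
  tfae_have 3 → 5 := fun ⟨_, _, h, hlim⟩ =>
    exists_isKuboAndoMean_of_powForm_le hA₁ hA₂ hC (isSubexponential_of_tendsto_log hlim)
      fun n hn => powForm_le_add_mul_max (h n hn).1 (h n hn).2.1 (h n hn).2.2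
  tfae_have 5 → 2 := fun ⟨t, ht, _, hG, hCG⟩ =>
    ⟨t, ht, fun n _ => (opPower_mono hC hCG n).trans (hG.opPower_le ht hA₁ hA₂ n)⟩
  tfae_have 2 → 3 := fun ⟨p, hp, h⟩ =>
    ⟨fun _ => p, fun _ => 1 - p, fun n hn => ⟨hp.1, sub_nonneg.2 hp.2, h n hn⟩, by simp⟩
  tfae_have 5 → 4 := fun ⟨t, ht, _, hG, hCG⟩ =>
    ⟨t, ht, fun _ _ _ hX => hG.powTr_le_of_le ht hA₁ hA₂ hC hCG hX⟩
  tfae_have 4 → 1 := fun ⟨_, ht, h⟩ n hn X hX =>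
    (h n hn X hX).trans (rpow_mul_rpow_le_max (powTr_nonneg hA₁ hX) (powTr_nonneg hA₂ hX) ht)
  tfae_finish
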